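/- Let $n\ge 1$, let $\Omega\subset\mathbb R^n$ be a bounded domain with smooth boundary $\Gamma$ and outer normal $\vec n$, let $\nu>0$, and let $G,\alpha\in W^{1,\infty}(\Omega)\cap W^{2,\max(2,n)}(\Omega)$ with $\nabla\alpha\cdot\vec n=0$ on $\Gamma$. Let $\mathcal Y=L^2(\Omega)$ (real valued), let $\mathbb 1$ be the constant function $1$, and $\mathbb 1^*y=\int_\Omega y\,dx$. Put $$\mathcal A\rho=\nu\Delta\rho+\nabla\cdot(\rho\nabla G),\qquad \mathcal D(\mathcal A)=\{\rho\in H^2(\Omega): (\nu\nabla\rho+\rho\nabla G)\cdot\vec n=0\text{ on }\Gamma\},$$ where the normal traces are understood in the weak sense (through Green's formula against $H^1(\Omega)$), and $$\rho_\infty=\frac{e^{-G/\nu}}{\int_\Omega e^{-G/\nu}\,dx},\qquad \mathcal B\colon\mathbb R\to\mathcal Y,\quad \mathcal Bc=c\,\nabla\cdot(\rho_\infty\nabla\alpha).$$ Let $\mathcal Y_{\mathcal P}=\{v\in\mathcal Y:\int_\Omega v\,dx=0\}$, let $I_{\mathcal P}\colon\mathcal Y_{\mathcal P}\to\mathcal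 Y$ be the injection, $\Theta\colon\mathcal Y\to\mathcal Y_{\mathcal P}$ the orthogonal projection, and $\mathcal P\colon\mathcal Y\to\mathcal Y_{\mathcal P}$, $\mathcal Py=y-\big(\int_\Omega y\,dx\big)\rho_\infty$. Let $\widehat{\mathcal A}=\mathcal AI_{\mathcal P}$ with domain $\mathcal D(\mathcal A)\cap\mathcal Y_{\mathcal P}$ and $\widehat{\mathcal B}=\mathcal P\mathcal B$, regarded as operators with values in $\mathcal Y_{\mathcal P}$. Let $\mathcal M\in\mathcal L(\mathcal Y_{\mathcal P})$ be self-adjoint and nonnegative, and let $\delta\in\mathbb R$ be such that the Hautus criterion holds: $$\ker(\lambda I-\widehat{\mathcal A}^*)\cap\ker\widehat{\mathcal B}^*=\{0\}\qquad\text{for every real }\lambda\ge-\delta .$$ Consider the two Riccati equations $$(\mathcal A^*+\delta\mathcal P^*)\Pi+\Pi(\mathcal A+\delta\mathcal P)-\Pi\mathcal B\mathcal B^*\Pi+\mathcal P^*\mathcal M\mathcal P=0,\qquad \Pi\in\mathcal L(\mathcal Y),\ \Pi^*=\Pi,\tag{R1}$$ $$(\widehat{\mathcal A}^*+\delta I)\widehat\Pi+\widehat\Pi(\widehat{\mathcal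 A}+\delta I)-\widehat\Pi\widehat{\mathcal B}\widehat{\mathcal B}^*\widehat\Pi+\mathcal M=0,\qquad \widehat\Pi\in\mathcal L(\mathcal Y_{\mathcal P}),\ \widehat\Pi^*=\widehat\Pi,\tag{R2}$$ both in the weak sense: (R1) means that for all $y_1,y_2\in\mathcal D(\mathcal A)$ $$\langle\Pi y_1,(\mathcal A+\delta\mathcal P)y_2\rangle+\langle\Pi(\mathcal A+\delta\mathcal P)y_1,y_2\rangle-\mathcal B^*\Pi y_1\cdot\mathcal B^*\Pi y_2+\langle\mathcal P^*\mathcal M\mathcal Py_1,y_2\rangle=0,$$ and (R2) means that for all $y_1,y_2\in\mathcal D(\widehat{\mathcal A})$ $$\langle\widehat\Pi y_1,(\widehat{\mathcal A}+\delta I)y_2\rangle+\langle\widehat\Pi(\widehat{\mathcal A}+\delta I)y_1,y_2\rangle-\widehat{\mathcal B}^*\widehat\Pi y_1\cdot\widehat{\mathcal B}^*\widehat\Pi y_2+\langle\mathcal My_1,y_2\rangle=0.$$ **Lemma.** If $\Pi\in\mathcal L(\mathcal Y)$ is a solution of (R1), then $\widehat\Pi:=\Theta\Pi I_{\mathcal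 P}\in\mathcal L(\mathcal Y_{\mathcal P})$ is a solution of (R2), and there exists $\gamma\in\mathbb R$ such that $\Pi=\mathcal P^*\widehat\Pi\mathcal P+\gamma\,\mathbb 1\mathbb 1^*$. Conversely, if $\widehat\Pi$ is a solution of (R2), then for every $\gamma\in\mathbb R$ the operator $\Pi=\mathcal P^*\widehat\Pi\mathcal P+\gamma\,\mathbb 1\mathbb 1^*$ is a solution of (R1). -/

import Mathlib

open MeasureTheory Set
open scoped ENNReal ContDiff InnerProductSpace

namespace FokkerPlanck

/-- Euclidean space `ℝⁿ`. -/
abbrev Eu (n : ℕ) : Type := EuclideanSpace ℝ (Fin n)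

/-- Test functions: `φ ∈ C_c^∞(Ω)`. -/
structure IsTest {n : ℕ} (Ω : Set (Eu n)) (φ : Eu n → ℝ) : Prop where
  smooth : ContDiff ℝ ∞ φ
  compact : HasCompactSupport φ
  support : tsupport φ ⊆ Ω

/-- `g` is a weak (distributional) gradient of `u` on `Ω`. -/
structure HasWeakGrad {n : ℕ} (Ω : Set (Eu n)) (u : Eu n → ℝ) (g : Eu n → Eu n) : Prop where
  left : LocallyIntegrableOn u Ω
  right : LocallyIntegrableOn g Ω
  parts : ∀ φ : Eu n → ℝ, IsTest Ω φ → ∀ i : Fin n,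
    ∫ x in Ω, u x * fderiv ℝ φ x (EuclideanSpace.single i 1) = -∫ x in Ω, g x i * φ x

/-- The square integrable vector field `F` has weak divergence `f ∈ L²(Ω)`. -/
structure HasWeakDiv {n : ℕ} (Ω : Set (Eu n)) (F : Eu n → Eu n) (f : Eu n → ℝ) : Prop where
  left : MemLp F 2 (volume.restrict Ω)
  right : MemLp f 2 (volume.restrict Ω)
  parts : ∀ φ : Eu n → ℝ, IsTest Ω φ →
    ∫ x in Ω, fderiv ℝ φ x (F x) = -∫ x in Ω, f x * φ x

/-- `u ∈ W^{1,p}(Ω)`. -/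
def MemW1 {n : ℕ} (Ω : Set (Eu n)) (p : ℝ≥0∞) (u : Eu n → ℝ) : Prop :=
  MemLp u p (volume.restrict Ω) ∧
    ∃ g, HasWeakGrad Ω u g ∧ MemLp g p (volume.restrict Ω)

/-- `u ∈ W^{2,p}(Ω)`. -/
def MemW2 {n : ℕ} (Ω : Set (Eu n)) (p : ℝ≥0∞) (u : Eu n → ℝ) : Prop :=
  MemLp u p (volume.restrict Ω) ∧
    ∃ g, HasWeakGrad Ω u g ∧ MemLp g p (volume.restrict Ω) ∧
      ∀ i : Fin n, MemW1 Ω p (fun x => g x i)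

/-- `F · n = 0` on `∂Ω` for a vector field `F ∈ L²(Ω; ℝⁿ)` with `div F ∈ L²(Ω)`: the normal trace
of `F`, the functional `v ↦ ∫_Ω F · ∇v + ∫_Ω (div F) v` on `H¹(Ω)`, is zero. -/
def NormalTraceZero {n : ℕ} (Ω : Set (Eu n)) (F : Eu n → Eu n) : Prop :=
  ∃ f, HasWeakDiv Ω F f ∧
    ∀ v g, MemLp v 2 (volume.restrict Ω) → MemLp g 2 (volume.restrict Ω) → HasWeakGrad Ω v g →
      (∫ x in Ω, ⟪F x, g x⟫_ℝ) + ∫ x in Ω, f x * v x = 0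

/-- `∂Ω` is smooth: near each boundary point, the open set `Ω` is the sublevel set of a smooth
function with nonzero gradient. -/
def HasSmoothBoundary {n : ℕ} (Ω : Set (Eu n)) : Prop :=
  ∀ x ∈ frontier Ω, ∃ U : Set (Eu n), IsOpen U ∧ x ∈ U ∧ ∃ h : Eu n → ℝ,
    ContDiffOn ℝ ∞ h U ∧ fderiv ℝ h x ≠ 0 ∧ Ω ∩ U = {y ∈ U | h y < 0}

open Classical in
/-- The weak gradient of `u` on `Ω`, unique up to null sets (`0` if there is none). -/
noncomputable def weakGrad {n : ℕ} (Ω : Set (Eu n)) (u : Eu n → ℝ) : Eu n → Eu n :=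
  if h : ∃ g, HasWeakGrad Ω u g then h.choose else 0

/-- The state space `L²(Ω)`. -/
abbrev L2 {n : ℕ} (Ω : Set (Eu n)) : Type := Lp ℝ 2 (volume.restrict Ω)

open Classical in
/-- The weak divergence of `F` as an element of `L²(Ω)`, which is unique (`0` if there is none). -/
noncomputable def weakDiv {n : ℕ} (Ω : Set (Eu n)) (F : Eu n → Eu n) : L2 Ω :=
  if h : ∃ f : L2 Ω, HasWeakDiv Ω F f then h.choose else 0

section Facts

variable {n : ℕ} {Ω : Set (Eu n)}

theorem integrable_mul_test {u ψ : Eu n → ℝ} (hu : LocallyIntegrableOn u Ω)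
    (hψ : Continuous ψ) (hc : HasCompactSupport ψ) (hs : tsupport ψ ⊆ Ω) :
    Integrable (fun x => u x * ψ x) := by
  have h1 : IntegrableOn u (tsupport ψ) := hu.integrableOn_compact_subset hs hc
  have h2 : IntegrableOn (fun x => u x * ψ x) (tsupport ψ) := h1.mul_continuousOn hψ.continuousOn hc
  refine (integrableOn_iff_integrable_of_support_subset ?_).1 h2
  intro x hx
  refine subset_tsupport ψ ?_
  intro h0
  exact hx (by simp [h0])

theorem IsTest.fderiv_cont {φ : Eu n → ℝ} (hφ : IsTest Ω φ) (w : Eu n) :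
    Continuous (fun x => fderiv ℝ φ x w) :=
  (hφ.smooth.continuous_fderiv (by simp)).clm_apply continuous_const

theorem IsTest.integrable_fderiv {φ u : Eu n → ℝ} (hφ : IsTest Ω φ)
    (hu : LocallyIntegrableOn u Ω) (w : Eu n) :
    IntegrableOn (fun x => u x * fderiv ℝ φ x w) Ω := by
  have hss : tsupport (fun x => fderiv ℝ φ x w) ⊆ tsupport φ := by
    refine closure_minimal ?_ (isClosed_tsupport φ)
    intro x hx
    refine support_fderiv_subset ℝ (f := φ) ?_
    intro h0
    exact hx (by simp [h0])
  exact (integrable_mul_test hu (hφ.fderiv_cont w)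
    (hφ.compact.of_isClosed_subset (isClosed_tsupport _) hss) (hss.trans hφ.support)).integrableOn

theorem coord_locallyIntegrableOn {g : Eu n → Eu n} (hg : LocallyIntegrableOn g Ω) (i : Fin n) :
    LocallyIntegrableOn (fun x => g x i) Ω := by
  intro x hx
  obtain ⟨s, hs, h⟩ := hg x hx
  exact ⟨s, hs, (EuclideanSpace.proj (𝕜 := ℝ) i).integrable_comp h⟩

theorem HasWeakGrad.add {u v : Eu n → ℝ} {g h : Eu n → Eu n} (hu : HasWeakGrad Ω u g)
    (hv : HasWeakGrad Ω v h) : HasWeakGrad Ω (u + v) (g + h) := by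
  refine ⟨hu.left.add hv.left, hu.right.add hv.right, fun φ hφ i => ?_⟩
  have e1 := hu.parts φ hφ i
  have e2 := hv.parts φ hφ i
  simp only [Pi.add_apply, PiLp.add_apply, add_mul]
  rw [integral_add (hφ.integrable_fderiv hu.left _) (hφ.integrable_fderiv hv.left _),
    integral_add
      (integrable_mul_test (coord_locallyIntegrableOn hu.right i) hφ.smooth.continuous hφ.compact
        hφ.support).integrableOn
      (integrable_mul_test (coord_locallyIntegrableOn hv.right i) hφ.smooth.continuous hφ.compact
        hφ.support).integrableOn, e1, e2]
  ring

theorem HasWeakGrad.smul {u : Eu n → ℝ} {g : Eu n → Eu n} (c : ℝ) (hu : HasWeakGrad Ω u g) :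
    HasWeakGrad Ω (c • u) (c • g) := by
  refine ⟨hu.left.smul c, hu.right.smul c, fun φ hφ i => ?_⟩
  have e1 := hu.parts φ hφ i
  simp only [Pi.smul_apply, PiLp.smul_apply, smul_eq_mul, mul_assoc]
  rw [integral_const_mul, integral_const_mul, e1]
  ring

theorem LocallyIntegrableOn.congr_aeΩ {X : Type*} [NormedAddCommGroup X] {u v : Eu n → X}
    (hΩ : IsOpen Ω) (hu : LocallyIntegrableOn u Ω)
    (h : u =ᵐ[volume.restrict Ω] v) : LocallyIntegrableOn v Ω := by
  rw [locallyIntegrableOn_iff hΩ.isLocallyClosed] at hu ⊢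
  intro k hk hc
  exact (hu k hk hc).congr (ae_restrict_of_ae_restrict_of_subset hk h)

theorem HasWeakGrad.congr {u v : Eu n → ℝ} {g : Eu n → Eu n} (hΩ : IsOpen Ω)
    (hu : HasWeakGrad Ω u g) (h : u =ᵐ[volume.restrict Ω] v) : HasWeakGrad Ω v g := by
  refine ⟨LocallyIntegrableOn.congr_aeΩ hΩ hu.left h, hu.right, fun φ hφ i => ?_⟩
  rw [← hu.parts φ hφ i]
  refine integral_congr_ae ?_
  filter_upwards [h] with x hx
  rw [hx]

theorem HasWeakGrad.unique {u : Eu n → ℝ} {g h : Eu n → Eu n} (hΩ : IsOpen Ω)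
    (hg : HasWeakGrad Ω u g) (hh : HasWeakGrad Ω u h) : g =ᵐ[volume.restrict Ω] h := by
  have key : ∀ i : Fin n, ∀ᵐ x ∂(volume.restrict Ω), g x i = h x i := by
    intro i
    rw [ae_restrict_iff' hΩ.measurableSet]
    have lg := coord_locallyIntegrableOn hg.right i
    have lh := coord_locallyIntegrableOn hh.right i
    have := hΩ.ae_eq_zero_of_integral_contDiff_smul_eq_zero (μ := volume)
      (f := fun x => g x i - h x i) (lg.sub lh) (fun φ h1 h2 h3 => by
        have hφ : IsTest Ω φ := ⟨h1, h2, h3⟩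
        have e1 := hg.parts φ hφ i
        have e2 := hh.parts φ hφ i
        have i1 := integrable_mul_test lg h1.continuous h2 h3
        have i2 := integrable_mul_test lh h1.continuous h2 h3
        have hz : ∀ k : Eu n → ℝ, ∫ x in Ω, k x * φ x = ∫ x, k x * φ x := fun k =>
          setIntegral_eq_integral_of_forall_compl_eq_zero (fun x hx => by
            rw [image_eq_zero_of_notMem_tsupport (fun hx' => hx (h3 hx')), mul_zero])
        rw [hz] at e1 e2
        have : ∫ x, φ x • (g x i - h x i) = (∫ x, g x i * φ x) - ∫ x, h x i * φ x := by
          rw [← integral_sub i1 i2]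
          congr 1
          ext x
          simp only [smul_eq_mul]
          ring
        rw [this]
        linarith)
    filter_upwards [this] with x hx hxΩ
    exact sub_eq_zero.1 (hx hxΩ)
  filter_upwards [ae_all_iff.2 key] with x hx
  ext i
  exact hx i

theorem weakGrad_spec {u : Eu n → ℝ} (h : ∃ g, HasWeakGrad Ω u g) :
    HasWeakGrad Ω u (weakGrad Ω u) := by
  rw [weakGrad, dif_pos h]
  exact h.choose_spec

theorem HasWeakGrad.weakGrad_ae {u : Eu n → ℝ} {g : Eu n → Eu n} (hΩ : IsOpen Ω)
    (h : HasWeakGrad Ω u g) : weakGrad Ω u =ᵐ[volume.restrict Ω] g :=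
  (weakGrad_spec ⟨g, h⟩).unique hΩ h

theorem MemW1.add {p : ℝ≥0∞} {u v : Eu n → ℝ} (hu : MemW1 Ω p u) (hv : MemW1 Ω p v) :
    MemW1 Ω p (u + v) := by
  obtain ⟨a, g, b, c⟩ := hu
  obtain ⟨a', g', b', c'⟩ := hv
  exact ⟨a.add a', g + g', b.add b', c.add c'⟩

theorem MemW1.smul {p : ℝ≥0∞} {u : Eu n → ℝ} (c : ℝ) (hu : MemW1 Ω p u) :
    MemW1 Ω p (c • u) := by
  obtain ⟨a, g, b, d⟩ := hu
  exact ⟨a.const_smul c, c • g, b.smul c, d.const_smul c⟩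

theorem MemW2.add {p : ℝ≥0∞} {u v : Eu n → ℝ} (hu : MemW2 Ω p u) (hv : MemW2 Ω p v) :
    MemW2 Ω p (u + v) := by
  obtain ⟨a, g, b, c, d⟩ := hu
  obtain ⟨a', g', b', c', d'⟩ := hv
  exact ⟨a.add a', g + g', b.add b', c.add c', fun i => (d i).add (d' i)⟩

theorem MemW2.smul {p : ℝ≥0∞} {u : Eu n → ℝ} (c : ℝ) (hu : MemW2 Ω p u) :
    MemW2 Ω p (c • u) := by
  obtain ⟨a, g, b, d, e⟩ := hu
  exact ⟨a.const_smul c, c • g, b.smul c, d.const_smul c, fun i => (e i).smul c⟩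

theorem MemW2.congr {p : ℝ≥0∞} {u v : Eu n → ℝ} (hΩ : IsOpen Ω) (hu : MemW2 Ω p u)
    (h : u =ᵐ[volume.restrict Ω] v) : MemW2 Ω p v := by
  obtain ⟨a, g, b, d, e⟩ := hu
  exact ⟨(memLp_congr_ae h).1 a, g, b.congr hΩ h, d, e⟩

theorem IsTest.integrable_fderiv_field {φ : Eu n → ℝ} {F : Eu n → Eu n} (hφ : IsTest Ω φ)
    (hF : MemLp F 2 (volume.restrict Ω)) :
    Integrable (fun x => fderiv ℝ φ x (F x)) (volume.restrict Ω) := by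
  have hc : Continuous (fderiv ℝ φ) := hφ.smooth.continuous_fderiv (by simp)
  have hD : MemLp (fderiv ℝ φ) 2 (volume.restrict Ω) :=
    hc.memLp_of_hasCompactSupport (hφ.compact.fderiv (𝕜 := ℝ))
  refine Integrable.mono' (hD.norm.integrable_mul hF.norm)
    (isBoundedBilinearMap_apply.continuous.comp_aestronglyMeasurable
      (hc.aestronglyMeasurable.prodMk hF.aestronglyMeasurable))
    (Filter.Eventually.of_forall fun x => ?_)
  exact (fderiv ℝ φ x).le_opNorm (F x)

theorem IsTest.integrable_mul {φ f : Eu n → ℝ} (hφ : IsTest Ω φ)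
    (hf : MemLp f 2 (volume.restrict Ω)) :
    Integrable (fun x => f x * φ x) (volume.restrict Ω) :=
  hf.integrable_mul (q := 2) (hφ.smooth.continuous.memLp_of_hasCompactSupport hφ.compact)

theorem HasWeakDiv.add {F F' : Eu n → Eu n} {f f' : Eu n → ℝ} (h : HasWeakDiv Ω F f)
    (h' : HasWeakDiv Ω F' f') : HasWeakDiv Ω (F + F') (f + f') := by
  refine ⟨h.left.add h'.left, h.right.add h'.right, fun φ hφ => ?_⟩
  have e1 := h.parts φ hφ
  have e2 := h'.parts φ hφ
  simp only [Pi.add_apply, map_add, add_mul]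
  rw [integral_add (hφ.integrable_fderiv_field h.left) (hφ.integrable_fderiv_field h'.left),
    integral_add (hφ.integrable_mul h.right) (hφ.integrable_mul h'.right), e1, e2]
  ring

theorem HasWeakDiv.smul {F : Eu n → Eu n} {f : Eu n → ℝ} (c : ℝ) (h : HasWeakDiv Ω F f) :
    HasWeakDiv Ω (c • F) (c • f) := by
  refine ⟨h.left.const_smul c, h.right.const_smul c, fun φ hφ => ?_⟩
  simp only [Pi.smul_apply, map_smul, smul_eq_mul, mul_assoc]
  rw [integral_const_mul, integral_const_mul, h.parts φ hφ]
  ring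

theorem HasWeakDiv.congr {F F' : Eu n → Eu n} {f f' : Eu n → ℝ} (h : HasWeakDiv Ω F f)
    (hF : F =ᵐ[volume.restrict Ω] F') (hf : f =ᵐ[volume.restrict Ω] f') :
    HasWeakDiv Ω F' f' := by
  refine ⟨(memLp_congr_ae hF).1 h.left, (memLp_congr_ae hf).1 h.right, fun φ hφ => ?_⟩
  have e := h.parts φ hφ
  rw [integral_congr_ae (g := fun x => fderiv ℝ φ x (F x)), e,
    integral_congr_ae (f := fun x => f x * φ x)]
  · filter_upwards [hf] with x hx
    rw [hx]
  · filter_upwards [hF] with x hx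
    rw [hx]

theorem HasWeakDiv.unique {F : Eu n → Eu n} {f f' : Eu n → ℝ} (hΩ : IsOpen Ω)
    (h : HasWeakDiv Ω F f) (h' : HasWeakDiv Ω F f') : f =ᵐ[volume.restrict Ω] f' := by
  have loc : ∀ k : Eu n → ℝ, MemLp k 2 (volume.restrict Ω) → LocallyIntegrableOn k Ω := by
    intro k hk
    exact locallyIntegrableOn_of_locallyIntegrable_restrict (hk.locallyIntegrable (by norm_num))
  have := hΩ.ae_eq_zero_of_integral_contDiff_smul_eq_zero (μ := volume)
    (f := fun x => f x - f' x) ((loc f h.right).sub (loc f' h'.right)) (fun φ h1 h2 h3 => by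
      have hφ : IsTest Ω φ := ⟨h1, h2, h3⟩
      have e1 := h.parts φ hφ
      have e2 := h'.parts φ hφ
      rw [← setIntegral_eq_integral_of_forall_compl_eq_zero (s := Ω) (fun x hx => by
        rw [image_eq_zero_of_notMem_tsupport (fun hx' => hx (h3 hx')), zero_smul])]
      have : ∫ x in Ω, φ x • (f x - f' x) = (∫ x in Ω, f x * φ x) - ∫ x in Ω, f' x * φ x := by
        rw [← integral_sub (hφ.integrable_mul h.right) (hφ.integrable_mul h'.right)]
        congr 1
        ext x
        simp only [smul_eq_mul]
        ring
      rw [this]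
      linarith)
  refine (ae_restrict_iff' hΩ.measurableSet).2 ?_
  filter_upwards [this] with x hx hxΩ
  exact sub_eq_zero.1 (hx hxΩ)

theorem weakDiv_spec {F : Eu n → Eu n} {f : Eu n → ℝ} (h : HasWeakDiv Ω F f) :
    HasWeakDiv Ω F (weakDiv Ω F) := by
  have hex : ∃ f : L2 Ω, HasWeakDiv Ω F f :=
    ⟨h.right.toLp f, h.congr Filter.EventuallyEq.rfl h.right.coeFn_toLp.symm⟩
  rw [weakDiv, dif_pos hex]
  exact hex.choose_spec

theorem weakDiv_eq {F : Eu n → Eu n} {f : L2 Ω} (hΩ : IsOpen Ω) (h : HasWeakDiv Ω F f) :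
    weakDiv Ω F = f :=
  Lp.ext ((weakDiv_spec h).unique hΩ h)

theorem integrable_inner_field {F g : Eu n → Eu n} (hF : MemLp F 2 (volume.restrict Ω))
    (hg : MemLp g 2 (volume.restrict Ω)) :
    Integrable (fun x => ⟪F x, g x⟫_ℝ) (volume.restrict Ω) :=
  Integrable.mono' (hF.norm.integrable_mul hg.norm)
    (hF.aestronglyMeasurable.inner hg.aestronglyMeasurable)
    (Filter.Eventually.of_forall fun x => norm_inner_le_norm (F x) (g x))

theorem NormalTraceZero.add {F F' : Eu n → Eu n} (h : NormalTraceZero Ω F)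
    (h' : NormalTraceZero Ω F') : NormalTraceZero Ω (F + F') := by
  obtain ⟨f, d, hf⟩ := h
  obtain ⟨f', d', hf'⟩ := h'
  refine ⟨f + f', d.add d', fun v g hv hg hvg => ?_⟩
  have e1 := hf v g hv hg hvg
  have e2 := hf' v g hv hg hvg
  simp only [Pi.add_apply, inner_add_left, add_mul]
  rw [integral_add (integrable_inner_field d.left hg) (integrable_inner_field d'.left hg),
    integral_add (f := fun x => f x * v x) (g := fun x => f' x * v x)
      (d.right.integrable_mul hv) (d'.right.integrable_mul hv)]
  linarith

theorem NormalTraceZero.smul {F : Eu n → Eu n} (c : ℝ) (h : NormalTraceZero Ω F) :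
    NormalTraceZero Ω (c • F) := by
  obtain ⟨f, d, hf⟩ := h
  refine ⟨c • f, d.smul c, fun v g hv hg hvg => ?_⟩
  simp only [Pi.smul_apply, real_inner_smul_left, smul_eq_mul, mul_assoc]
  rw [integral_const_mul, integral_const_mul, ← mul_add, hf v g hv hg hvg, mul_zero]

theorem NormalTraceZero.congr {F F' : Eu n → Eu n} (h : NormalTraceZero Ω F)
    (hF : F =ᵐ[volume.restrict Ω] F') : NormalTraceZero Ω F' := by
  obtain ⟨f, d, hf⟩ := h
  refine ⟨f, d.congr hF Filter.EventuallyEq.rfl, fun v g hv hg hvg => ?_⟩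
  rw [← hf v g hv hg hvg]
  congr 1
  refine integral_congr_ae ?_
  filter_upwards [hF] with x hx
  rw [hx]

end Facts

/-- The probability current `ν ∇u + u ∇G`. -/
noncomputable def flux {n : ℕ} (Ω : Set (Eu n)) (ν : ℝ) (G u : Eu n → ℝ) : Eu n → Eu n :=
  fun x => ν • weakGrad Ω u x + u x • weakGrad Ω G x

/-- The data of the controlled Fokker-Planck equation: a bounded domain with smooth boundary, the
diffusion coefficient `ν`, the ground potential `G` and the control shape function `α`. -/
structure Problem (n : ℕ) where
  /-- the domain -/
  Ω : Set (Eu n)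
  isOpen : IsOpen Ω
  isConnected : IsConnected Ω
  isBounded : Bornology.IsBounded Ω
  smoothBoundary : HasSmoothBoundary Ω
  /-- the diffusion coefficient -/
  ν : ℝ
  ν_pos : 0 < ν
  /-- the ground potential -/
  G : Eu n → ℝ
  G_W1 : MemW1 Ω ∞ G
  G_W2 : MemW2 Ω (max 2 (n : ℝ≥0∞)) G
  /-- the control shape function -/
  α : Eu n → ℝ
  α_W1 : MemW1 Ω ∞ α
  α_W2 : MemW2 Ω (max 2 (n : ℝ≥0∞)) α
  α_neumann : NormalTraceZero Ω (weakGrad Ω α)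

namespace Problem

variable {n : ℕ} (D : Problem n)

theorem flux_add_ae {u v : Eu n → ℝ} (hu : ∃ g, HasWeakGrad D.Ω u g)
    (hv : ∃ g, HasWeakGrad D.Ω v g) :
    flux D.Ω D.ν D.G u + flux D.Ω D.ν D.G v =ᵐ[volume.restrict D.Ω]
      flux D.Ω D.ν D.G (u + v) := by
  filter_upwards [((weakGrad_spec hu).add (weakGrad_spec hv)).weakGrad_ae D.isOpen] with x hx
  simp only [flux, Pi.add_apply] at hx ⊢
  rw [hx]
  module

theorem flux_smul_ae {u : Eu n → ℝ} (c : ℝ) (hu : ∃ g, HasWeakGrad D.Ω u g) :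
    c • flux D.Ω D.ν D.G u =ᵐ[volume.restrict D.Ω] flux D.Ω D.ν D.G (c • u) := by
  filter_upwards [((weakGrad_spec hu).smul c).weakGrad_ae D.isOpen] with x hx
  simp only [flux, Pi.smul_apply] at hx ⊢
  rw [hx, smul_eq_mul]
  module

theorem flux_congr_ae {u v : Eu n → ℝ} (hu : ∃ g, HasWeakGrad D.Ω u g)
    (h : u =ᵐ[volume.restrict D.Ω] v) :
    flux D.Ω D.ν D.G u =ᵐ[volume.restrict D.Ω] flux D.Ω D.ν D.G v := by
  filter_upwards [((weakGrad_spec hu).congr D.isOpen h).weakGrad_ae D.isOpen, h] with x hx h'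
  simp only [flux]
  rw [hx, h']

theorem flux_add (u v : L2 D.Ω) (hu : MemW2 D.Ω 2 u) (hv : MemW2 D.Ω 2 v) :
    flux D.Ω D.ν D.G u + flux D.Ω D.ν D.G v =ᵐ[volume.restrict D.Ω]
      flux D.Ω D.ν D.G ((u + v : L2 D.Ω) : Eu n → ℝ) := by
  obtain ⟨_, g, hg, _⟩ := id hu
  obtain ⟨_, h, hh, _⟩ := id hv
  exact (D.flux_add_ae ⟨g, hg⟩ ⟨h, hh⟩).trans
    (D.flux_congr_ae ⟨_, hg.add hh⟩ (Lp.coeFn_add u v).symm)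

theorem flux_smul (c : ℝ) (u : L2 D.Ω) (hu : MemW2 D.Ω 2 u) :
    c • flux D.Ω D.ν D.G u =ᵐ[volume.restrict D.Ω]
      flux D.Ω D.ν D.G ((c • u : L2 D.Ω) : Eu n → ℝ) := by
  obtain ⟨_, g, hg, _⟩ := id hu
  exact (D.flux_smul_ae c ⟨g, hg⟩).trans
    (D.flux_congr_ae ⟨_, hg.smul c⟩ (Lp.coeFn_smul c u).symm)

/-- `D(A) = {ρ ∈ H²(Ω) | (ν ∇ρ + ρ ∇G) · n = 0 on ∂Ω}`. -/
noncomputable def domA : Submodule ℝ (L2 D.Ω) where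
  carrier := {ρ | MemW2 D.Ω 2 ρ ∧ NormalTraceZero D.Ω (flux D.Ω D.ν D.G ρ)}
  zero_mem' := by
    have hg : HasWeakGrad D.Ω (0 : Eu n → ℝ) (0 : Eu n → Eu n) :=
      ⟨locallyIntegrableOn_zero, locallyIntegrableOn_zero, by simp⟩
    have hm : MemW2 D.Ω 2 ((0 : L2 D.Ω) : Eu n → ℝ) :=
      MemW2.congr D.isOpen ⟨MemLp.zero, 0, hg, MemLp.zero, fun i =>
        ⟨MemLp.zero, 0, hg, MemLp.zero⟩⟩ (Lp.coeFn_zero ℝ 2 (volume.restrict D.Ω)).symm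
    have h0 := D.flux_smul 0 0 hm
    rw [zero_smul, zero_smul] at h0
    exact ⟨hm, NormalTraceZero.congr ⟨0, ⟨MemLp.zero, MemLp.zero, by simp⟩, by simp⟩ h0⟩
  add_mem' := by
    rintro u v ⟨hu, hu'⟩ ⟨hv, hv'⟩
    exact ⟨(hu.add hv).congr D.isOpen (Lp.coeFn_add u v).symm,
      (hu'.add hv').congr (D.flux_add u v hu hv)⟩
  smul_mem' := by
    rintro c u ⟨hu, hu'⟩
    exact ⟨(hu.smul c).congr D.isOpen (Lp.coeFn_smul c u).symm,
      (hu'.smul c).congr (D.flux_smul c u hu)⟩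

theorem domA_spec (ρ : D.domA) :
    HasWeakDiv D.Ω (flux D.Ω D.ν D.G (ρ : L2 D.Ω)) (weakDiv D.Ω (flux D.Ω D.ν D.G (ρ : L2 D.Ω))) :=
  weakDiv_spec ρ.2.2.choose_spec.1

/-- The Fokker-Planck operator `A ρ = ν Δρ + ∇ · (ρ ∇G) = ∇ · (ν ∇ρ + ρ ∇G)` with domain `D(A)`. -/
noncomputable def A : L2 D.Ω →ₗ.[ℝ] L2 D.Ω where
  domain := D.domA
  toFun :=
    { toFun := fun ρ => weakDiv D.Ω (flux D.Ω D.ν D.G (ρ : L2 D.Ω))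
      map_add' := fun u v => weakDiv_eq D.isOpen
        (((D.domA_spec u).add (D.domA_spec v)).congr (D.flux_add u v u.2.1 v.2.1)
          (Lp.coeFn_add _ _).symm)
      map_smul' := fun c u => weakDiv_eq D.isOpen
        (((D.domA_spec u).smul c).congr (D.flux_smul c u u.2.1) (Lp.coeFn_smul _ _).symm) }

theorem isFiniteMeasure : IsFiniteMeasure (volume.restrict D.Ω) :=
  ⟨by rw [Measure.restrict_apply_univ]; exact D.isBounded.measure_lt_top⟩

theorem memLp_one : MemLp (fun _ : Eu n => (1 : ℝ)) 2 (volume.restrict D.Ω) :=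
  haveI := D.isFiniteMeasure
  memLp_const 1

/-- The constant function `𝟙`. -/
noncomputable def one : L2 D.Ω := D.memLp_one.toLp _

theorem inner_one (y : L2 D.Ω) : ⟪D.one, y⟫_ℝ = ∫ x in D.Ω, y x := by
  rw [L2.inner_def]
  refine integral_congr_ae ?_
  filter_upwards [D.memLp_one.coeFn_toLp] with x hx
  rw [one, hx]
  simp

/-- The stationary density `ρ_∞ = e^{-G/ν} / ∫_Ω e^{-G/ν}`. -/
noncomputable def rhoFun : Eu n → ℝ :=
  fun x => Real.exp (-(D.G x) / D.ν) / ∫ z in D.Ω, Real.exp (-(D.G z) / D.ν)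

theorem memLp_exp : MemLp (fun x => Real.exp (-(D.G x) / D.ν)) ∞ (volume.restrict D.Ω) := by
  have hG := D.G_W1.1
  have hν := D.ν_pos
  refine memLp_top_of_bound (C := Real.exp ((eLpNormEssSup D.G (volume.restrict D.Ω)).toReal / D.ν))
    ?_ ?_
  · exact Real.continuous_exp.comp_aestronglyMeasurable
      (hG.aestronglyMeasurable.neg.mul_const D.ν⁻¹)
  · have hfin : eLpNormEssSup D.G (volume.restrict D.Ω) ≠ (⊤ : ℝ≥0∞) := by
      have := hG.eLpNorm_ne_top
      rwa [eLpNorm_exponent_top] at this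
    filter_upwards [ae_le_eLpNormEssSup (f := D.G) (μ := volume.restrict D.Ω)] with x hx
    have h1 : ‖D.G x‖ ≤ (eLpNormEssSup D.G (volume.restrict D.Ω)).toReal := by
      have := ENNReal.toReal_mono hfin hx
      simpa using this
    rw [Real.norm_eq_abs, Real.abs_exp, Real.exp_le_exp]
    have h2 : -D.G x ≤ ‖D.G x‖ := neg_le_abs _
    gcongr
    exact h2.trans h1

theorem memLp_rho : MemLp D.rhoFun 2 (volume.restrict D.Ω) := by
  have := D.isFiniteMeasure
  have h : MemLp (fun x => Real.exp (-(D.G x) / D.ν)) 2 (volume.restrict D.Ω) :=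
    D.memLp_exp.mono_exponent le_top
  exact h.mul_const (∫ z in D.Ω, Real.exp (-(D.G z) / D.ν))⁻¹

/-- `ρ_∞` as an element of `L²(Ω)`. -/
noncomputable def rho : L2 D.Ω := D.memLp_rho.toLp _

theorem integral_rho : ⟪D.one, D.rho⟫_ℝ = 1 := by
  have := D.isFiniteMeasure
  rw [inner_one, rho, integral_congr_ae D.memLp_rho.coeFn_toLp]
  have hi : Integrable (fun x => Real.exp (-(D.G x) / D.ν)) (volume.restrict D.Ω) :=
    D.memLp_exp.integrable le_top
  have hne : NeZero (volume.restrict D.Ω) := ⟨by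
    rw [Ne, Measure.restrict_eq_zero]
    exact (D.isOpen.measure_pos volume D.isConnected.nonempty).ne'⟩
  have hpos : 0 < ∫ z in D.Ω, Real.exp (-(D.G z) / D.ν) := integral_exp_pos hi
  simp only [rhoFun]
  rw [integral_div, div_self hpos.ne']

/-- `Y_P = {v ∈ L²(Ω) | ∫_Ω v = 0}`, the orthogonal complement of `𝟙`. -/
noncomputable def YP : Submodule ℝ (L2 D.Ω) := (ℝ ∙ D.one)ᗮ

theorem mem_YP (v : L2 D.Ω) : v ∈ D.YP ↔ ∫ x in D.Ω, v x = 0 := by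
  rw [YP, Submodule.mem_orthogonal_singleton_iff_inner_right, inner_one]

noncomputable instance : CompleteSpace D.YP :=
  inferInstanceAs (CompleteSpace (ℝ ∙ D.one)ᗮ)

/-- The projection `P y = y - (∫_Ω y) ρ_∞`, as an operator from `L²(Ω)` to its range `Y_P`. -/
noncomputable def P : L2 D.Ω →L[ℝ] D.YP :=
  (ContinuousLinearMap.id ℝ (L2 D.Ω) - (innerSL ℝ D.one).smulRight D.rho).codRestrict D.YP
    (fun y => by
      rw [YP, Submodule.mem_orthogonal_singleton_iff_inner_right]
      simp [inner_sub_right, inner_smul_right, D.integral_rho])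

theorem P_apply (y : L2 D.Ω) : (D.P y : L2 D.Ω) = y - (∫ x in D.Ω, y x) • D.rho := by
  simp [P, ← D.inner_one]

/-- The injection `I_P` of `Y_P` into `L²(Ω)`. -/
noncomputable def IP : D.YP →L[ℝ] L2 D.Ω := D.YP.subtypeL

/-- The orthogonal projection `Θ` onto `Y_P`, as an operator from `L²(Ω)` to `Y_P`. -/
noncomputable def Θ : L2 D.Ω →L[ℝ] D.YP := D.YP.orthogonalProjectionOnto

/-- The rank one operator `𝟙𝟙* y = (∫_Ω y) 𝟙`. -/
noncomputable def oneOne : L2 D.Ω →L[ℝ] L2 D.Ω := InnerProductSpace.rankOne ℝ D.one D.one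

/-- The control operator `B c = c ∇ · (ρ_∞ ∇α)`. -/
noncomputable def B : ℝ →L[ℝ] L2 D.Ω :=
  ContinuousLinearMap.toSpanSingleton ℝ
    (weakDiv D.Ω (fun x => D.rhoFun x • weakGrad D.Ω D.α x))

/-- The control operator `B̂ = P B`, as an operator with values in `Y_P`. -/
noncomputable def Bhat : ℝ →L[ℝ] D.YP := D.P ∘L D.B

theorem A_mem_YP (y : D.A.domain) : D.A y ∈ D.YP := by
  rw [mem_YP]
  obtain ⟨f, hd, hf⟩ := y.2.2
  have hg : HasWeakGrad D.Ω (fun _ => (1 : ℝ)) (0 : Eu n → Eu n) := by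
    refine ⟨(continuous_const.locallyIntegrable).locallyIntegrableOn _,
      locallyIntegrableOn_zero, fun φ hφ i => ?_⟩
    have hz : ∀ x ∉ D.Ω, (1 : ℝ) * fderiv ℝ φ x (EuclideanSpace.single i 1) = 0 := by
      intro x hx
      have : x ∉ Function.support (fderiv ℝ φ) := fun h =>
        hx (hφ.support (support_fderiv_subset ℝ h))
      rw [Function.notMem_support.1 this]
      simp
    have hφi : Integrable φ := hφ.smooth.continuous.integrable_of_hasCompactSupport hφ.compact
    have hdi : Integrable (fun x => fderiv ℝ φ x (EuclideanSpace.single i 1)) :=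
      (hφ.fderiv_cont _).integrable_of_hasCompactSupport (hφ.compact.fderiv_apply (𝕜 := ℝ) _)
    rw [setIntegral_eq_integral_of_forall_compl_eq_zero hz,
      integral_mul_fderiv_eq_neg_fderiv_mul_of_integrable (f := fun _ => (1 : ℝ)) (g := φ)
        (by simp) (by simpa using hdi) (by simpa using hφi)
        (fun x _ => differentiableAt_const _)
        (fun x _ => (hφ.smooth.differentiable (by simp)).differentiableAt)]
    simp
  have e := hf _ _ D.memLp_one MemLp.zero hg
  have hae : f =ᵐ[volume.restrict D.Ω] D.A y := hd.unique D.isOpen (D.domA_spec y)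
  rw [← integral_congr_ae hae]
  simpa using e

/-- The operator `Â = A I_P` in `Y_P`, with domain `D(A) ∩ Y_P`. -/
noncomputable def Ahat : D.YP →ₗ.[ℝ] D.YP where
  domain := D.A.domain.comap D.YP.subtype
  toFun :=
    { toFun := fun y => ⟨D.A ⟨y, y.2⟩, D.A_mem_YP _⟩
      map_add' := fun u v => Subtype.ext (D.A.map_add ⟨u, u.2⟩ ⟨v, v.2⟩)
      map_smul' := fun c u => Subtype.ext (D.A.map_smul c ⟨u, u.2⟩) }

/-- The Hautus criterion for `(Â, B̂)` and the rate `δ`: `ker (λ - Â*) ∩ ker B̂* = 0` for every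
`λ ≥ -δ` (the spectrum of `Â*` is real). -/
def Hautus (δ : ℝ) : Prop :=
  ∀ lam : ℝ, -δ ≤ lam → ∀ φ : D.Ahat.adjoint.domain,
    D.Ahat.adjoint φ = lam • (φ : D.YP) → D.Bhat.adjoint (φ : D.YP) = 0 → (φ : D.YP) = 0

/-- `Π ∈ L(L²(Ω))` is self-adjoint and solves
`(A* + δ P*) Π + Π (A + δ P) - Π B B* Π + P* M P = 0`, in the weak sense on `D(A)`. -/
def SolvesR1 (δ : ℝ) (M : D.YP →L[ℝ] D.YP) (Pi : L2 D.Ω →L[ℝ] L2 D.Ω) : Prop :=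
  IsSelfAdjoint Pi ∧ ∀ y₁ y₂ : D.A.domain,
    ⟪Pi y₁, D.A y₂ + δ • (D.P y₂ : L2 D.Ω)⟫_ℝ + ⟪Pi (D.A y₁ + δ • (D.P y₁ : L2 D.Ω)), y₂⟫_ℝ
      - ⟪D.B.adjoint (Pi y₁), D.B.adjoint (Pi y₂)⟫_ℝ
      + ⟪(D.P.adjoint ∘L M ∘L D.P) y₁, (y₂ : L2 D.Ω)⟫_ℝ = 0

/-- `Π̂ ∈ L(Y_P)` is self-adjoint and solves
`(Â* + δ I) Π̂ + Π̂ (Â + δ I) - Π̂ B̂ B̂* Π̂ + M = 0`, in the weak sense on `D(Â)`. -/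
def SolvesR2 (δ : ℝ) (M Pihat : D.YP →L[ℝ] D.YP) : Prop :=
  IsSelfAdjoint Pihat ∧ ∀ y₁ y₂ : D.Ahat.domain,
    ⟪Pihat y₁, D.Ahat y₂ + δ • (y₂ : D.YP)⟫_ℝ + ⟪Pihat (D.Ahat y₁ + δ • (y₁ : D.YP)), y₂⟫_ℝ
      - ⟪D.Bhat.adjoint (Pihat y₁), D.Bhat.adjoint (Pihat y₂)⟫_ℝ
      + ⟪M y₁, (y₂ : D.YP)⟫_ℝ = 0

end Problem

end FokkerPlanck

/-! ### Mollification, and the chain and product rules for weak gradients. -/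

namespace FokkerPlanck

open Filter Topology Convolution ContinuousLinearMap

variable {n : ℕ} {Ω : Set (Eu n)}

/-! Everything rests on the splitting of `L²(Ω)` into `Y_P` and the line of `ρ_∞`, along which `P`
projects. Three facts tie it to the dynamics: `A ρ_∞ = 0` (`A_rho`), `A` takes values in `Y_P`
(conservation of mass), and so does `B` (`B_mem_YP`). Hence `P` intertwines `A + δP` with `Â + δ`,
while `𝟙` is orthogonal to the ranges of `A + δP` and `B`.

Restricting (R1) to `Y_P` gives (R2) for the compression of `Π`. Conversely, for `Π = P*Π̂P + γ𝟙𝟙*`,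
equation (R1) at `y₁, y₂` is (R2) at `P y₁, P y₂`, since every term carrying `γ` has a factor that
vanishes.

The form of `Π` comes from `SolvesR1.apply_rho`. Testing (R1) with `ρ_∞` twice leaves `|B*Πρ_∞|² =
0`; testing with `ρ_∞` once then says that `ΘΠρ_∞` lies in the kernel of `Â* + δ`. It also lies in
the kernel of `B̂*`, so Hautus at `λ = -δ` makes it zero, and `Πρ_∞ = γ𝟙`. Symmetry and the
splitting determine the rest.

The analytic work is to justify the three facts and the density of the domain of `Â`, without which
its adjoint carries no information. It uses the product rule for `ρ_∞ v` and Green's formula against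
`H¹(Ω)`. -/

theorem norm_convolution_normed_le (η : ContDiffBump (0 : Eu n)) {f : Eu n → ℝ} {C : ℝ}
    (hf : ∀ᵐ x, ‖f x‖ ≤ C) (x : Eu n) :
    ‖(η.normed volume ⋆[lsmul ℝ ℝ, volume] f) x‖ ≤ C := by
  rw [convolution_lsmul_swap]
  have hi : Integrable (fun t => η.normed volume (x - t) * C) :=
    ((η.integrable_normed (μ := volume)).comp_sub_left x).mul_const C
  refine (norm_integral_le_of_norm_le hi ?_).trans_eq ?_
  · filter_upwards [hf] with t ht
    rw [norm_smul, Real.norm_of_nonneg (η.nonneg_normed _)]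
    exact mul_le_mul_of_nonneg_left ht (η.nonneg_normed _)
  · rw [integral_mul_const, integral_sub_left_eq_self (η.normed volume) volume x,
      η.integral_normed, one_mul]

/-- Mollification commutes with weak differentiation away from the boundary. -/
theorem HasWeakGrad.fderiv_convolution {u : Eu n → ℝ} {g : Eu n → Eu n} (h : HasWeakGrad Ω u g)
    (hΩ : MeasurableSet Ω) (hu : LocallyIntegrable (Ω.indicator u)) {η : Eu n → ℝ}
    (hη : ContDiff ℝ ∞ η) (hc : HasCompactSupport η) {x : Eu n}
    (hx : ∀ t, x - t ∈ tsupport η → t ∈ Ω) (i : Fin n) :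
    fderiv ℝ (η ⋆[lsmul ℝ ℝ, volume] Ω.indicator u) x (EuclideanSpace.single i 1) =
      (η ⋆[lsmul ℝ ℝ, volume] Ω.indicator (fun y => g y i)) x := by
  have hη1 : ContDiff ℝ 1 η := hη.of_le (by exact_mod_cast le_top)
  rw [(hc.hasFDerivAt_convolution_left (lsmul ℝ ℝ) hη1 hu x).fderiv]
  have hex := ((hc.fderiv (𝕜 := ℝ)).convolutionExists_left ((lsmul ℝ ℝ).precompL (Eu n))
    (hη1.continuous_fderiv one_ne_zero) hu x).integrable_swap
  rw [convolution_eq_swap, ContinuousLinearMap.integral_apply hex, convolution_lsmul_swap]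
  have hsupp : tsupport (fun t => η (x - t)) = (fun t => x - t) ⁻¹' tsupport η :=
    tsupport_comp_eq_preimage η (Homeomorph.subLeft x)
  -- The reflected and translated mollifier is a test function of `t`, its support lying in `Ω` by
  -- `hx`. The sign from the reflection cancels the one in the integration by parts.
  have hψ : IsTest Ω (fun t => η (x - t)) :=
    ⟨hη.comp (contDiff_const.sub contDiff_id), hc.comp_homeomorph (Homeomorph.subLeft x), by
      rw [hsupp]; exact hx⟩
  have hd : ∀ t, fderiv ℝ (fun t => η (x - t)) t (EuclideanSpace.single i 1) =
      -fderiv ℝ η (x - t) (EuclideanSpace.single i 1) := by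
    intro t
    have h1 : HasFDerivAt (fun t => x - t) (-(ContinuousLinearMap.id ℝ (Eu n))) t := by
      simpa using (hasFDerivAt_id (𝕜 := ℝ) t).const_sub x
    have h2 := ((hη1.differentiable one_ne_zero (x - t)).hasFDerivAt).comp t h1
    rw [show (fun t => η (x - t)) = η ∘ fun t => x - t from rfl, h2.fderiv]
    simp
  have e := h.parts _ hψ i
  simp only [hd, mul_neg] at e
  rw [integral_neg, neg_inj, ← integral_indicator hΩ, ← integral_indicator hΩ] at e
  have e1 : ∀ t, (((lsmul ℝ ℝ).precompL (Eu n)) (fderiv ℝ η (x - t)) (Ω.indicator u t))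
      (EuclideanSpace.single i 1) =
      Ω.indicator (fun t => u t * fderiv ℝ η (x - t) (EuclideanSpace.single i 1)) t := by
    intro t
    by_cases ht : t ∈ Ω <;> simp [ht, mul_comm]
  have e2 : ∀ t, η (x - t) • Ω.indicator (fun y => g y i) t =
      Ω.indicator (fun t => g t i * η (x - t)) t := by
    intro t
    by_cases ht : t ∈ Ω <;> simp [ht, mul_comm]
  simp only [e1, e2]
  exact e

/-- Extension by zero makes convolution on the whole space available; the bound is the essential
supremum. -/
theorem exists_bound_indicator {f : Eu n → ℝ} (hΩ : MeasurableSet Ω)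
    (hf : MemLp f ∞ (volume.restrict Ω)) :
    LocallyIntegrable (Ω.indicator f) ∧ ∃ C, ∀ᵐ x, ‖Ω.indicator f x‖ ≤ C := by
  have h := (memLp_indicator_iff_restrict hΩ).2 hf
  refine ⟨h.locallyIntegrable le_top, (eLpNorm (Ω.indicator f) ∞ volume).toReal, ?_⟩
  have hfin := h.eLpNorm_ne_top
  rw [eLpNorm_exponent_top] at hfin ⊢
  filter_upwards [ae_le_eLpNormEssSup (f := Ω.indicator f) (μ := volume)] with x hx
  simpa using ENNReal.toReal_mono hfin hx

theorem memLp_coord {p : ℝ≥0∞} {g : Eu n → Eu n} (hg : MemLp g p (volume.restrict Ω))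
    (i : Fin n) : MemLp (fun x => g x i) p (volume.restrict Ω) :=
  (EuclideanSpace.proj (𝕜 := ℝ) i).comp_memLp' hg

/-- Almost all values of `u` lie in one compact ball, where `F` is bounded, so no growth condition
on `F` is needed. -/
theorem memLp_comp_top {u : Eu n → ℝ} (hu : MemLp u ∞ (volume.restrict Ω)) {F : ℝ → ℝ}
    (hF : Continuous F) : MemLp (fun x => F (u x)) ∞ (volume.restrict Ω) := by
  have hfin : eLpNormEssSup u (volume.restrict Ω) ≠ (⊤ : ℝ≥0∞) := by
    have := hu.eLpNorm_ne_top
    rwa [eLpNorm_exponent_top] at this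
  obtain ⟨C, hC⟩ := (isCompact_closedBall (0 : ℝ)
    (eLpNormEssSup u (volume.restrict Ω)).toReal).exists_bound_of_continuousOn hF.continuousOn
  refine memLp_top_of_bound (hF.comp_aestronglyMeasurable hu.aestronglyMeasurable) C ?_
  filter_upwards [ae_le_eLpNormEssSup (f := u) (μ := volume.restrict Ω)] with x hx
  exact hC _ (by simpa using ENNReal.toReal_mono hfin hx)

theorem LocallyIntegrableOn.mul_memLp_top {f : Eu n → ℝ} {X : Type*} [NormedAddCommGroup X]
    [NormedSpace ℝ X] {v : Eu n → X} (hΩ : IsOpen Ω) (hv : LocallyIntegrableOn v Ω)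
    (hf : MemLp f ∞ (volume.restrict Ω)) : LocallyIntegrableOn (fun x => f x • v x) Ω := by
  rw [locallyIntegrableOn_iff hΩ.isLocallyClosed] at hv ⊢
  intro k hk hc
  have h1 : MemLp v 1 (volume.restrict k) := memLp_one_iff_integrable.2 (hv k hk hc)
  have h2 : MemLp f ∞ (volume.restrict k) := hf.mono_measure (Measure.restrict_mono hk le_rfl)
  exact memLp_one_iff_integrable.1 (h1.smul h2)

/-- The fixed ratio of outer to inner radius is what almost everywhere convergence of the
mollifications (Lebesgue differentiation) requires. -/
theorem exists_bump_sequence (n : ℕ) : ∃ η : ℕ → ContDiffBump (0 : Eu n),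
    (∀ k, (η k).rOut = 2 * (η k).rIn) ∧ Tendsto (fun k => (η k).rOut) atTop (𝓝 0) := by
  refine ⟨fun k => ⟨1 / ((k : ℝ) + 1), 2 * (1 / ((k : ℝ) + 1)), by positivity, ?_⟩,
    fun k => rfl, ?_⟩
  · have : (0 : ℝ) < 1 / ((k : ℝ) + 1) := by positivity
    linarith
  · simpa using (tendsto_one_div_add_atTop_nhds_zero_nat (𝕜 := ℝ)).const_mul 2

/-- Chain and product rule. -/
theorem HasWeakGrad.comp_mul {u v : Eu n → ℝ} {g h : Eu n → Eu n} (hΩ : IsOpen Ω)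
    (hu : HasWeakGrad Ω u g) (hu' : MemLp u ∞ (volume.restrict Ω))
    (hg' : MemLp g ∞ (volume.restrict Ω)) (hv : HasWeakGrad Ω v h) {F : ℝ → ℝ}
    (hF : ContDiff ℝ ∞ F) :
    HasWeakGrad Ω (fun x => F (u x) * v x)
      (fun x => F (u x) • h x + deriv F (u x) • v x • g x) := by
  have hF' : Continuous (deriv F) := hF.continuous_deriv (by exact_mod_cast le_top)
  have hFu := memLp_comp_top hu' hF.continuous
  have hFu' := memLp_comp_top hu' hF'
  have hFv : LocallyIntegrableOn (fun x => F (u x) * v x) Ω :=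
    LocallyIntegrableOn.mul_memLp_top hΩ hv.left hFu
  have hFh := LocallyIntegrableOn.mul_memLp_top hΩ hv.right hFu
  have hvg' : LocallyIntegrableOn (fun x => v x • g x) Ω := by
    rw [locallyIntegrableOn_iff hΩ.isLocallyClosed]
    intro k hk hc
    have h1 : MemLp v 1 (volume.restrict k) :=
      memLp_one_iff_integrable.2 (hv.left.integrableOn_compact_subset hk hc)
    have h2 : MemLp g ∞ (volume.restrict k) := hg'.mono_measure (Measure.restrict_mono hk le_rfl)
    exact memLp_one_iff_integrable.1 (h2.smul h1)
  refine ⟨hFv, hFh.add (LocallyIntegrableOn.mul_memLp_top hΩ hvg' hFu'), fun φ hφ i => ?_⟩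
  obtain ⟨η, hη2, hη0⟩ := exists_bump_sequence n
  obtain ⟨hUi, C, hC⟩ := exists_bound_indicator hΩ.measurableSet hu'
  obtain ⟨hGi, C', hC'⟩ := exists_bound_indicator hΩ.measurableSet (memLp_coord hg' i)
  obtain ⟨C₁, hC₁⟩ := (isCompact_closedBall (0 : ℝ) C).exists_bound_of_continuousOn
    hF.continuous.continuousOn
  obtain ⟨C₂, hC₂⟩ := (isCompact_closedBall (0 : ℝ) C).exists_bound_of_continuousOn
    hF'.continuousOn
  set w : ℕ → Eu n → ℝ := fun k => (η k).normed volume ⋆[lsmul ℝ ℝ, volume] Ω.indicator u with hw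
  set W : ℕ → Eu n → ℝ := fun k =>
    (η k).normed volume ⋆[lsmul ℝ ℝ, volume] Ω.indicator (fun y => g y i) with hW
  have hwC : ∀ k x, ‖w k x‖ ≤ C := fun k x => norm_convolution_normed_le (η k) hC x
  have hWC : ∀ k x, ‖W k x‖ ≤ C' := fun k x => norm_convolution_normed_le (η k) hC' x
  have hwsm : ∀ k, ContDiff ℝ ∞ (w k) := fun k =>
    (η k).hasCompactSupport_normed.contDiff_convolution_left _ (η k).contDiff_normed hUi
  have hWc : ∀ k, Continuous (W k) := fun k =>
    (η k).hasCompactSupport_normed.continuous_convolution_left _ (η k).continuous_normed hGi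
  have hwt : ∀ᵐ x, Tendsto (fun k => w k x) atTop (𝓝 (Ω.indicator u x)) :=
    ContDiffBump.ae_convolution_tendsto_right_of_locallyIntegrable hη0
      (Eventually.of_forall fun k => (hη2 k).le) hUi
  have hWt : ∀ᵐ x, Tendsto (fun k => W k x) atTop (𝓝 (Ω.indicator (fun y => g y i) x)) :=
    ContDiffBump.ae_convolution_tendsto_right_of_locallyIntegrable hη0
      (Eventually.of_forall fun k => (hη2 k).le) hGi
  set e : Eu n := EuclideanSpace.single i 1 with he
  -- Once the mollifier has radius below `r`, the mollification at a point of the support of `φ`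
  -- only sees points of `Ω`, so `W k` is there the partial derivative of `w k`.
  obtain ⟨r, hr0, hr⟩ := hφ.compact.exists_cthickening_subset_open hΩ hφ.support
  have hderiv : ∀ᶠ k in atTop, ∀ x, φ x * fderiv ℝ (w k) x e = φ x * W k x := by
    filter_upwards [hη0.eventually (gt_mem_nhds hr0)] with k hk x
    by_cases hx : x ∈ tsupport φ
    · congr 1
      refine hu.fderiv_convolution hΩ.measurableSet hUi (η k).contDiff_normed
        (η k).hasCompactSupport_normed (fun t ht => hr ?_) i
      rw [(η k).tsupport_normed_eq, mem_closedBall_zero_iff] at ht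
      refine Metric.mem_cthickening_of_dist_le t x r _ hx ?_
      rw [dist_comm, dist_eq_norm]
      exact ht.trans hk.le
    · rw [image_eq_zero_of_notMem_tsupport hx, zero_mul, zero_mul]
  have i1 := hφ.integrable_fderiv hv.left e
  have i2 : IntegrableOn (fun x => v x * φ x) Ω :=
    (integrable_mul_test hv.left hφ.smooth.continuous hφ.compact hφ.support).integrableOn
  have i3 : IntegrableOn (fun x => h x i * φ x) Ω :=
    (integrable_mul_test (coord_locallyIntegrableOn hv.right i) hφ.smooth.continuous hφ.compact
      hφ.support).integrableOn
  -- For large `k` this integrand expresses the weak gradient identity of `v` against the test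
  -- function `φ · F(w k)`, all terms on one side. The limit in `k` is the claim, by dominated
  -- convergence with the uniform bounds on `w k` and `W k`.
  set T : ℕ → Eu n → ℝ := fun k x => v x * fderiv ℝ φ x e * F (w k x)
    + v x * φ x * (deriv F (w k x) * W k x) + h x i * φ x * F (w k x) with hT
  have bF : ∀ k x, ‖F (w k x)‖ ≤ C₁ := fun k x =>
    hC₁ _ (mem_closedBall_zero_iff.2 (hwC k x))
  have bF' : ∀ k x, ‖deriv F (w k x) * W k x‖ ≤ C₂ * C' := fun k x => by
    rw [norm_mul]
    have := hC₂ _ (mem_closedBall_zero_iff.2 (hwC k x))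
    exact mul_le_mul this (hWC k x) (norm_nonneg _) ((norm_nonneg _).trans this)
  have cF : ∀ k, Continuous (fun x => F (w k x)) := fun k =>
    hF.continuous.comp (hwsm k).continuous
  have cF' : ∀ k, Continuous (fun x => deriv F (w k x) * W k x) := fun k =>
    (hF'.comp (hwsm k).continuous).mul (hWc k)
  have int1 : ∀ k, IntegrableOn (fun x => v x * fderiv ℝ φ x e * F (w k x)) Ω := fun k =>
    Integrable.mul_bdd (c := C₁) i1 (cF k).aestronglyMeasurable (Eventually.of_forall (bF k))
  have int2 : ∀ k, IntegrableOn (fun x => v x * φ x * (deriv F (w k x) * W k x)) Ω := fun k =>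
    Integrable.mul_bdd (c := C₂ * C') i2 (cF' k).aestronglyMeasurable (Eventually.of_forall (bF' k))
  have int3 : ∀ k, IntegrableOn (fun x => h x i * φ x * F (w k x)) Ω := fun k =>
    Integrable.mul_bdd (c := C₁) i3 (cF k).aestronglyMeasurable (Eventually.of_forall (bF k))
  have hzero : ∀ᶠ k in atTop, ∫ x in Ω, T k x = 0 := by
    filter_upwards [hderiv] with k hk
    have hFw : ContDiff ℝ ∞ (fun x => F (w k x)) := hF.comp (hwsm k)
    have htest : IsTest Ω (fun x => φ x * F (w k x)) :=
      ⟨hφ.smooth.mul hFw, hφ.compact.mul_right, (tsupport_mul_subset_left).trans hφ.support⟩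
    have hd : ∀ x, fderiv ℝ (fun x => φ x * F (w k x)) x e =
        fderiv ℝ φ x e * F (w k x) + φ x * (deriv F (w k x) * W k x) := by
      intro x
      have d1 := (hφ.smooth.differentiable (by simp) x).hasFDerivAt
      have d2 := ((hwsm k).differentiable (by simp) x).hasFDerivAt
      have d3 := (hF.differentiable (by simp) (w k x)).hasDerivAt
      rw [show (fun x => φ x * F (w k x)) = φ * F ∘ w k from rfl,
        (d1.mul (d3.comp_hasFDerivAt x d2)).fderiv]
      have := hk x
      simp only [_root_.add_apply, _root_.smul_apply, smul_eq_mul,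
        Function.comp_apply]
      linear_combination deriv F (w k x) * this
    have hp := hv.parts _ htest i
    rw [← he] at hp
    simp only [hd] at hp
    have s1 : ∫ x in Ω, T k x = (∫ x in Ω, v x * (fderiv ℝ φ x e * F (w k x)
        + φ x * (deriv F (w k x) * W k x))) + ∫ x in Ω, h x i * (φ x * F (w k x)) := by
      refine (integral_add ((int1 k).add (int2 k)) (int3 k)).trans ?_
      congr 1 <;> exact integral_congr_ae (Eventually.of_forall fun x => by
        simp only [Pi.add_apply]; ring)
    rw [s1, hp]
    simp
  have hlim : Tendsto (fun k => ∫ x in Ω, T k x) atTop (𝓝 (∫ x in Ω,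
      (v x * fderiv ℝ φ x e * F (u x) + v x * φ x * (deriv F (u x) * g x i)
        + h x i * φ x * F (u x)))) := by
    refine tendsto_integral_of_dominated_convergence
      (fun x => ‖v x * fderiv ℝ φ x e‖ * C₁ + ‖v x * φ x‖ * (C₂ * C') + ‖h x i * φ x‖ * C₁)
      (fun k => (((int1 k).add (int2 k)).add (int3 k)).aestronglyMeasurable)
      (((i1.norm.mul_const _).add (i2.norm.mul_const _)).add (i3.norm.mul_const _))
      (fun k => Eventually.of_forall fun x => ?_) ?_
    · refine (norm_add₃_le).trans ?_
      rw [norm_mul _ (F (w k x)), norm_mul _ (deriv F (w k x) * W k x), norm_mul _ (F (w k x))]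
      gcongr
      · exact bF k x
      · exact bF' k x
      · exact bF k x
    · filter_upwards [ae_restrict_of_ae hwt, ae_restrict_of_ae hWt,
        ae_restrict_mem hΩ.measurableSet] with x hx hx' hxΩ
      rw [indicator_of_mem hxΩ] at hx hx'
      have t1 : Tendsto (fun k => F (w k x)) atTop (𝓝 (F (u x))) :=
        (hF.continuous.tendsto _).comp hx
      have t2 : Tendsto (fun k => deriv F (w k x)) atTop (𝓝 (deriv F (u x))) :=
        (hF'.tendsto _).comp hx
      exact ((t1.const_mul _).add ((t2.mul hx').const_mul _)).add (t1.const_mul _)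
  have key := tendsto_nhds_unique hlim (tendsto_const_nhds.congr' (hzero.mono fun k hk => hk.symm))
  have j1 : IntegrableOn (fun x => F (u x) * v x * fderiv ℝ φ x e) Ω := hφ.integrable_fderiv hFv e
  have j2 : IntegrableOn (fun x =>
      (F (u x) • h x + deriv F (u x) • v x • g x) i * φ x) Ω :=
    (integrable_mul_test (coord_locallyIntegrableOn
      (hFh.add (LocallyIntegrableOn.mul_memLp_top hΩ hvg' hFu')) i) hφ.smooth.continuous
      hφ.compact hφ.support).integrableOn
  rw [← sub_eq_zero, sub_neg_eq_add, ← integral_add j1 j2, ← key]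
  refine integral_congr_ae (Eventually.of_forall fun x => ?_)
  simp only [PiLp.add_apply, PiLp.smul_apply, smul_eq_mul]
  ring

end FokkerPlanck

/-! ### Test functions, Green's formula and fields with zero normal trace. -/

namespace FokkerPlanck

open Filter Topology

variable {n : ℕ} {Ω : Set (Eu n)}

theorem hasWeakGrad_one (Ω : Set (Eu n)) : HasWeakGrad Ω (fun _ => (1 : ℝ)) 0 := by
  refine ⟨(continuous_const.locallyIntegrable).locallyIntegrableOn _,
    locallyIntegrableOn_zero, fun φ hφ i => ?_⟩
  have hz : ∀ x ∉ Ω, (1 : ℝ) * fderiv ℝ φ x (EuclideanSpace.single i 1) = 0 := by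
    intro x hx
    have : x ∉ Function.support (fderiv ℝ φ) := fun h =>
      hx (hφ.support (support_fderiv_subset ℝ h))
    rw [Function.notMem_support.1 this]
    simp
  have hφi : Integrable φ := hφ.smooth.continuous.integrable_of_hasCompactSupport hφ.compact
  have hdi : Integrable (fun x => fderiv ℝ φ x (EuclideanSpace.single i 1)) :=
    (hφ.fderiv_cont _).integrable_of_hasCompactSupport (hφ.compact.fderiv_apply (𝕜 := ℝ) _)
  rw [setIntegral_eq_integral_of_forall_compl_eq_zero hz,
    integral_mul_fderiv_eq_neg_fderiv_mul_of_integrable (f := fun _ => (1 : ℝ)) (g := φ)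
      (by simp) (by simpa using hdi) (by simpa using hφi)
      (fun x _ => differentiableAt_const _)
      (fun x _ => (hφ.smooth.differentiable (by simp)).differentiableAt)]
  simp

theorem gradient_apply_coord (φ : Eu n → ℝ) (x : Eu n) (i : Fin n) :
    gradient φ x i = fderiv ℝ φ x (EuclideanSpace.single i 1) := by
  have h := InnerProductSpace.toDual_symm_apply (𝕜 := ℝ) (x := EuclideanSpace.single i (1 : ℝ))
    (y := fderiv ℝ φ x)
  rw [← h, EuclideanSpace.inner_single_right]
  simp [gradient]

theorem IsTest.memLp {φ : Eu n → ℝ} (hφ : IsTest Ω φ) (p : ℝ≥0∞) :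
    MemLp φ p (volume.restrict Ω) :=
  hφ.smooth.continuous.memLp_of_hasCompactSupport hφ.compact

theorem IsTest.continuous_gradient {φ : Eu n → ℝ} (hφ : IsTest Ω φ) :
    Continuous (gradient φ) :=
  (InnerProductSpace.toDual ℝ (Eu n)).symm.continuous.comp
    (hφ.smooth.continuous_fderiv (by simp))

theorem IsTest.memLp_gradient {φ : Eu n → ℝ} (hφ : IsTest Ω φ) (p : ℝ≥0∞) :
    MemLp (gradient φ) p (volume.restrict Ω) :=
  hφ.continuous_gradient.memLp_of_hasCompactSupport
    ((hφ.compact.fderiv (𝕜 := ℝ)).comp_left (map_zero _))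

theorem IsTest.fderiv_apply {φ : Eu n → ℝ} (hφ : IsTest Ω φ) (w : Eu n) :
    IsTest Ω (fun x => fderiv ℝ φ x w) where
  smooth := (hφ.smooth.fderiv_right (m := ∞) (by simp)).clm_apply contDiff_const
  compact := hφ.compact.fderiv_apply (𝕜 := ℝ) w
  support := by
    refine Subset.trans (closure_minimal (fun x hx => ?_) (isClosed_tsupport φ)) hφ.support
    refine support_fderiv_subset ℝ (f := φ) fun h0 => hx ?_
    simp [h0]

/-- Product rule with a test function. -/
theorem HasWeakGrad.mul_test {v φ : Eu n → ℝ} {h : Eu n → Eu n} (hΩ : IsOpen Ω)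
    (hv : HasWeakGrad Ω v h) (hφ : IsTest Ω φ) :
    HasWeakGrad Ω (fun x => φ x * v x) (fun x => φ x • h x + v x • gradient φ x) := by
  have l1 : LocallyIntegrableOn (fun x => φ x * v x) Ω :=
    LocallyIntegrableOn.mul_memLp_top hΩ hv.left (hφ.memLp ∞)
  have l2 : LocallyIntegrableOn (fun x => v x • gradient φ x) Ω := by
    rw [locallyIntegrableOn_iff hΩ.isLocallyClosed]
    intro k hk hc
    have h1 : MemLp v 1 (volume.restrict k) :=
      memLp_one_iff_integrable.2 (hv.left.integrableOn_compact_subset hk hc)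
    have h2 : MemLp (gradient φ) ∞ (volume.restrict k) :=
      (hφ.memLp_gradient ∞).mono_measure (Measure.restrict_mono hk le_rfl)
    exact memLp_one_iff_integrable.1 (h2.smul h1)
  have l3 := (LocallyIntegrableOn.mul_memLp_top hΩ hv.right (hφ.memLp ∞)).add l2
  refine ⟨l1, l3, fun ψ hψ i => ?_⟩
  have htest : IsTest Ω (fun x => φ x * ψ x) :=
    ⟨hφ.smooth.mul hψ.smooth, hφ.compact.mul_right, tsupport_mul_subset_left.trans hφ.support⟩
  have hd : ∀ x w, fderiv ℝ (fun x => φ x * ψ x) x w =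
      φ x * fderiv ℝ ψ x w + ψ x * fderiv ℝ φ x w := by
    intro x w
    rw [fderiv_fun_mul (hφ.smooth.differentiable (by simp) x)
      (hψ.smooth.differentiable (by simp) x)]
    simp
  have e := hv.parts _ htest i
  have i1 := htest.integrable_fderiv hv.left (EuclideanSpace.single i 1)
  have i2 : IntegrableOn (fun x => h x i * (φ x * ψ x)) Ω :=
    (integrable_mul_test (coord_locallyIntegrableOn hv.right i) htest.smooth.continuous
      htest.compact htest.support).integrableOn
  have j1 := hψ.integrable_fderiv l1 (EuclideanSpace.single i 1)
  have j2 : IntegrableOn (fun x => (φ x • h x + v x • gradient φ x) i * ψ x) Ω :=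
    (integrable_mul_test (coord_locallyIntegrableOn l3 i) hψ.smooth.continuous
      hψ.compact hψ.support).integrableOn
  rw [← sub_eq_zero, sub_neg_eq_add, ← integral_add i1 i2] at e
  rw [← sub_eq_zero, sub_neg_eq_add, ← integral_add j1 j2, ← e]
  refine integral_congr_ae (Eventually.of_forall fun x => ?_)
  simp only [PiLp.add_apply, PiLp.smul_apply, smul_eq_mul, hd, gradient_apply_coord]
  ring

theorem IsTest.hasWeakGrad {φ : Eu n → ℝ} (hΩ : IsOpen Ω) (hφ : IsTest Ω φ) :
    HasWeakGrad Ω φ (gradient φ) := by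
  simpa using (hasWeakGrad_one Ω).mul_test hΩ hφ

theorem MemW1.congr {p : ℝ≥0∞} {u v : Eu n → ℝ} (hΩ : IsOpen Ω) (hu : MemW1 Ω p u)
    (h : u =ᵐ[volume.restrict Ω] v) : MemW1 Ω p v := by
  obtain ⟨a, g, b, c⟩ := hu
  exact ⟨(memLp_congr_ae h).1 a, g, b.congr hΩ h, c⟩

theorem MemW1.mul_test {u φ : Eu n → ℝ} (hΩ : IsOpen Ω) (hu : MemW1 Ω 2 u) (hφ : IsTest Ω φ) :
    MemW1 Ω 2 (fun x => φ x * u x) := by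
  obtain ⟨a, g, b, c⟩ := hu
  refine ⟨a.mul (hφ.memLp ∞), _, b.mul_test hΩ hφ, ?_⟩
  exact (c.smul (hφ.memLp ∞)).add ((hφ.memLp_gradient ∞).smul a)

theorem MemW2.mul_test {u φ : Eu n → ℝ} (hΩ : IsOpen Ω) (hu : MemW2 Ω 2 u) (hφ : IsTest Ω φ) :
    MemW2 Ω 2 (fun x => φ x * u x) := by
  obtain ⟨a, g, b, c, d⟩ := hu
  refine ⟨a.mul (hφ.memLp ∞), _, b.mul_test hΩ hφ,
    (c.smul (hφ.memLp ∞)).add ((hφ.memLp_gradient ∞).smul a), fun i => ?_⟩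
  have h1 := (d i).mul_test hΩ hφ
  -- The `i`-th component of `u ∇φ` is `u` times the test function `∂ᵢφ`, so the first-order case
  -- applies again.
  have h2 := MemW1.mul_test hΩ ⟨a, g, b, c⟩ (hφ.fderiv_apply (EuclideanSpace.single i 1))
  convert h1.add h2 using 1
  ext x
  simp only [PiLp.add_apply, PiLp.smul_apply, smul_eq_mul, gradient_apply_coord, Pi.add_apply]
  ring

/-- Green's formula against `H¹` determines the weak divergence. -/
theorem normalTraceZero_of_green {F : Eu n → Eu n} {f : Eu n → ℝ} (hΩ : IsOpen Ω)
    (hF : MemLp F 2 (volume.restrict Ω)) (hf : MemLp f 2 (volume.restrict Ω))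
    (h : ∀ v g, MemLp v 2 (volume.restrict Ω) → MemLp g 2 (volume.restrict Ω) →
      HasWeakGrad Ω v g → (∫ x in Ω, ⟪F x, g x⟫_ℝ) + ∫ x in Ω, f x * v x = 0) :
    NormalTraceZero Ω F := by
  refine ⟨f, ⟨hF, hf, fun φ hφ => ?_⟩, h⟩
  rw [← add_eq_zero_iff_eq_neg, ← h φ (gradient φ) (hφ.memLp 2) (hφ.memLp_gradient 2)
    (hφ.hasWeakGrad hΩ)]
  simp only [gradient, ← real_inner_comm (F _), InnerProductSpace.toDual_symm_apply]

/-- The divergence is the Laplacian, and Green's formula is the sum over `i` of the weak gradient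
identities of `v` against `∂ᵢφ`. -/
theorem IsTest.normalTraceZero_gradient {φ : Eu n → ℝ} (hΩ : IsOpen Ω) (hφ : IsTest Ω φ) :
    NormalTraceZero Ω (gradient φ) := by
  set e : Fin n → Eu n := fun i => EuclideanSpace.single i 1 with he
  have hd : ∀ i, IsTest Ω (fun x => fderiv ℝ φ x (e i)) := fun i => hφ.fderiv_apply _
  have hdd : ∀ i, IsTest Ω (fun x => fderiv ℝ (fun y => fderiv ℝ φ y (e i)) x (e i)) :=
    fun i => (hd i).fderiv_apply _
  refine normalTraceZero_of_green hΩ (hφ.memLp_gradient 2)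
    (f := fun x => ∑ i, fderiv ℝ (fun y => fderiv ℝ φ y (e i)) x (e i))
    (memLp_finsetSum _ fun i _ => (hdd i).memLp 2) fun v g hv hg hvg => ?_
  have i1 : ∀ i, Integrable (fun x => g x i * fderiv ℝ φ x (e i)) (volume.restrict Ω) :=
    fun i => (hd i).integrable_mul (memLp_coord hg i)
  have i2 : ∀ i, Integrable (fun x => v x * fderiv ℝ (fun y => fderiv ℝ φ y (e i)) x (e i))
      (volume.restrict Ω) := fun i => (hdd i).integrable_mul hv
  have e1 : ∀ x, ⟪gradient φ x, g x⟫_ℝ = ∑ i, g x i * fderiv ℝ φ x (e i) := by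
    intro x
    rw [PiLp.inner_apply]
    refine Finset.sum_congr rfl fun i _ => ?_
    rw [gradient_apply_coord]
    rfl
  have e2 : ∀ x, (∑ i, fderiv ℝ (fun y => fderiv ℝ φ y (e i)) x (e i)) * v x =
      ∑ i, v x * fderiv ℝ (fun y => fderiv ℝ φ y (e i)) x (e i) := by
    intro x
    rw [Finset.sum_mul]
    exact Finset.sum_congr rfl fun i _ => mul_comm _ _
  simp only [e1, e2]
  rw [integral_finsetSum _ fun i _ => i1 i, integral_finsetSum _ fun i _ => i2 i,
    ← Finset.sum_add_distrib]
  exact Finset.sum_eq_zero fun i _ => by rw [hvg.parts _ (hd i) i, add_neg_cancel]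

/-! ### The stationary density, conservation of mass and density of the domains. -/

namespace Problem

variable (D : Problem n)

theorem memLp_weakGrad_top {u : Eu n → ℝ} (hu : MemW1 D.Ω ∞ u) :
    MemLp (weakGrad D.Ω u) ∞ (volume.restrict D.Ω) := by
  obtain ⟨_, g, hg, hg'⟩ := hu
  exact (memLp_congr_ae (hg.weakGrad_ae D.isOpen)).2 hg'

theorem hasWeakGrad_weakGrad {p : ℝ≥0∞} {u : Eu n → ℝ} (hu : MemW1 D.Ω p u) :
    HasWeakGrad D.Ω u (weakGrad D.Ω u) := by
  obtain ⟨_, g, hg, _⟩ := hu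
  exact weakGrad_spec ⟨g, hg⟩

/-- On a bounded domain the exponent `max 2 n` can be lowered to `2`. -/
theorem memW1_weakGrad_coord (i : Fin n) : MemW1 D.Ω 2 (fun x => weakGrad D.Ω D.G x i) := by
  have := D.isFiniteMeasure
  obtain ⟨_, g, hg, _, h⟩ := D.G_W2
  obtain ⟨a, k, b, c⟩ := h i
  refine MemW1.congr D.isOpen ⟨a.mono_exponent (le_max_left _ _), k, b,
    c.mono_exponent (le_max_left _ _)⟩ ?_
  filter_upwards [hg.weakGrad_ae D.isOpen] with x hx
  rw [hx]

theorem memLp_rhoFun_top : MemLp D.rhoFun ∞ (volume.restrict D.Ω) :=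
  D.memLp_exp.mul_const (∫ z in D.Ω, Real.exp (-(D.G z) / D.ν))⁻¹

theorem normalizer_pos : 0 < ∫ z in D.Ω, Real.exp (-(D.G z) / D.ν) := by
  have := D.isFiniteMeasure
  have hne : NeZero (volume.restrict D.Ω) := ⟨by
    rw [Ne, Measure.restrict_eq_zero]
    exact (D.isOpen.measure_pos volume D.isConnected.nonempty).ne'⟩
  exact integral_exp_pos (D.memLp_exp.integrable le_top)

theorem rhoFun_pos (x : Eu n) : 0 < D.rhoFun x :=
  div_pos (Real.exp_pos _) D.normalizer_pos

/-- `∇(ρ_∞ v) = ρ_∞ (∇v - (v / ν) ∇G)`. -/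
theorem hasWeakGrad_rho_mul {v : Eu n → ℝ} {h : Eu n → Eu n} (hv : HasWeakGrad D.Ω v h) :
    HasWeakGrad D.Ω (fun x => D.rhoFun x * v x)
      (fun x => D.rhoFun x • h x - (D.rhoFun x * v x / D.ν) • weakGrad D.Ω D.G x) := by
  set Z := ∫ z in D.Ω, Real.exp (-(D.G z) / D.ν) with hZ
  -- `ρ_∞` is this smooth function composed with `G`, so chain and product rule apply at once.
  have hF : ContDiff ℝ ∞ (fun t : ℝ => Real.exp (-t / D.ν) / Z) := by fun_prop
  have hd : ∀ t, deriv (fun t : ℝ => Real.exp (-t / D.ν) / Z) t =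
      -(Real.exp (-t / D.ν) / Z) / D.ν := by
    intro t
    have h1 : HasDerivAt (fun t : ℝ => -t / D.ν) (-1 / D.ν) t :=
      (hasDerivAt_id t).neg.div_const D.ν
    rw [(h1.exp.div_const Z).deriv]
    ring
  have key := (D.hasWeakGrad_weakGrad D.G_W1).comp_mul D.isOpen D.G_W1.1
    (D.memLp_weakGrad_top D.G_W1) hv hF
  simp only [hd] at key
  refine (congrArg (HasWeakGrad D.Ω _) (funext fun x => ?_)).mpr key
  rw [sub_eq_add_neg, ← neg_smul, smul_smul, rhoFun, ← hZ]
  congr 2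
  ring

theorem memW1_rho_mul {v : Eu n → ℝ} (hv : MemW1 D.Ω 2 v) :
    MemW1 D.Ω 2 (fun x => D.rhoFun x * v x) := by
  obtain ⟨a, h, b, c⟩ := hv
  have hρv : MemLp (fun x => D.rhoFun x * v x) 2 (volume.restrict D.Ω) :=
    a.mul D.memLp_rhoFun_top
  exact ⟨hρv, _, D.hasWeakGrad_rho_mul b, (c.smul D.memLp_rhoFun_top).sub
    ((D.memLp_weakGrad_top D.G_W1).smul (hρv.mul_const D.ν⁻¹))⟩

theorem hasWeakGrad_rhoFun :
    HasWeakGrad D.Ω D.rhoFun (fun x => -(D.rhoFun x / D.ν) • weakGrad D.Ω D.G x) := by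
  simpa using D.hasWeakGrad_rho_mul (hasWeakGrad_one D.Ω)

/-- The components of `∇ρ_∞` are `-ν⁻¹ ρ_∞ ∂ᵢG` with `∂ᵢG` in `H¹`, so the product rule with `ρ_∞`
gives the second derivatives. -/
theorem memW2_rhoFun : MemW2 D.Ω 2 D.rhoFun := by
  refine ⟨D.memLp_rho, _, D.hasWeakGrad_rhoFun, ?_, fun i => ?_⟩
  · exact (D.memLp_weakGrad_top D.G_W1).smul (D.memLp_rho.mul_const D.ν⁻¹).neg
  · convert (D.memW1_rho_mul (D.memW1_weakGrad_coord i)).smul (-D.ν⁻¹) using 1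
    ext x
    simp only [PiLp.smul_apply, Pi.smul_apply, smul_eq_mul]
    ring

/-- Multiplication by `ρ_∞` preserves fields with zero normal trace. -/
theorem normalTraceZero_rho_smul {F : Eu n → Eu n} (hF : NormalTraceZero D.Ω F) :
    NormalTraceZero D.Ω (fun x => D.rhoFun x • F x) := by
  obtain ⟨f, d, hf⟩ := hF
  have hG := D.memLp_weakGrad_top D.G_W1
  have hFG : MemLp (fun x => ⟪F x, weakGrad D.Ω D.G x⟫_ℝ) 2 (volume.restrict D.Ω) := by
    refine (hG.norm.mul (r := 2) d.left.norm).mono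
      (d.left.aestronglyMeasurable.inner hG.aestronglyMeasurable) ?_
    refine Eventually.of_forall fun x => ?_
    simpa using norm_inner_le_norm (𝕜 := ℝ) (F x) (weakGrad D.Ω D.G x)
  have hρF : MemLp (fun x => D.rhoFun x • F x) 2 (volume.restrict D.Ω) :=
    d.left.smul D.memLp_rhoFun_top
  -- This is the divergence of `ρ_∞ F`, since `∇ρ_∞ = -(ρ_∞/ν) ∇G`. Green's formula for `ρ_∞ F`
  -- against `v` is the one for `F` against `ρ_∞ v`.
  have hf' : MemLp (fun x => D.rhoFun x * (f x - D.ν⁻¹ * ⟪F x, weakGrad D.Ω D.G x⟫_ℝ)) 2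
      (volume.restrict D.Ω) :=
    (d.right.sub (hFG.const_mul D.ν⁻¹)).mul D.memLp_rhoFun_top
  refine normalTraceZero_of_green D.isOpen hρF hf' fun v h hv hh hvh => ?_
  have hρv : MemLp (fun x => D.rhoFun x * v x) 2 (volume.restrict D.Ω) :=
    hv.mul D.memLp_rhoFun_top
  have hgrad : MemLp (fun x => D.rhoFun x • h x -
      (D.rhoFun x * v x / D.ν) • weakGrad D.Ω D.G x) 2 (volume.restrict D.Ω) :=
    (hh.smul D.memLp_rhoFun_top).sub (hG.smul (hρv.mul_const D.ν⁻¹))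
  have i1 : Integrable (fun x => D.rhoFun x * (f x - D.ν⁻¹ * ⟪F x, weakGrad D.Ω D.G x⟫_ℝ) * v x)
    (volume.restrict D.Ω) := hf'.integrable_mul hv
  have i2 : Integrable (fun x => f x * (D.rhoFun x * v x)) (volume.restrict D.Ω) :=
    d.right.integrable_mul hρv
  rw [← hf _ _ hρv hgrad (D.hasWeakGrad_rho_mul hvh),
    ← integral_add (integrable_inner_field hρF hh) i1,
    ← integral_add (integrable_inner_field d.left hgrad) i2]
  refine integral_congr_ae (Eventually.of_forall fun x => ?_)
  simp only [inner_sub_right, real_inner_smul_left, real_inner_smul_right]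
  ring

/-- Green's formula against the constant `1`: no flux through the boundary, no change of mass. -/
theorem weakDiv_mem_YP {F : Eu n → Eu n} (hF : NormalTraceZero D.Ω F) :
    weakDiv D.Ω F ∈ D.YP := by
  obtain ⟨f, d, hf⟩ := hF
  rw [mem_YP, integral_congr_ae ((weakDiv_spec d).unique D.isOpen d)]
  simpa using hf _ _ D.memLp_one MemLp.zero (hasWeakGrad_one D.Ω)

/-- The condition `∇α · n = 0` enters here; it makes `P` act as the identity on the range of `B`. -/
theorem B_mem_YP (c : ℝ) : D.B c ∈ D.YP := by
  rw [B, ContinuousLinearMap.toSpanSingleton_apply]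
  exact D.YP.smul_mem c (D.weakDiv_mem_YP (D.normalTraceZero_rho_smul D.α_neumann))

theorem flux_ae {u : Eu n → ℝ} {g : Eu n → Eu n} (h : HasWeakGrad D.Ω u g) :
    flux D.Ω D.ν D.G u =ᵐ[volume.restrict D.Ω]
      fun x => D.ν • g x + u x • weakGrad D.Ω D.G x := by
  filter_upwards [h.weakGrad_ae D.isOpen] with x hx
  rw [flux, hx]

/-- Diffusion and drift cancel pointwise, as `ν∇ρ_∞ = -ρ_∞∇G`. -/
theorem flux_rhoFun_ae : flux D.Ω D.ν D.G D.rho =ᵐ[volume.restrict D.Ω] 0 := by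
  filter_upwards [D.flux_ae (D.hasWeakGrad_rhoFun.congr D.isOpen D.memLp_rho.coeFn_toLp.symm),
    D.memLp_rho.coeFn_toLp] with x hx hx'
  rw [rho, hx, hx', smul_smul, ← add_smul]
  have := D.ν_pos.ne'
  rw [show D.ν * -(D.rhoFun x / D.ν) + D.rhoFun x = 0 by field_simp; ring, zero_smul]
  rfl

theorem hasWeakDiv_zero : HasWeakDiv D.Ω 0 0 :=
  ⟨MemLp.zero, MemLp.zero, by simp⟩

theorem rho_mem_domA : D.rho ∈ D.domA :=
  ⟨D.memW2_rhoFun.congr D.isOpen D.memLp_rho.coeFn_toLp.symm,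
    NormalTraceZero.congr ⟨0, D.hasWeakDiv_zero, by simp⟩ D.flux_rhoFun_ae.symm⟩

theorem A_rho : D.A ⟨D.rho, D.rho_mem_domA⟩ = 0 :=
  weakDiv_eq D.isOpen (D.hasWeakDiv_zero.congr D.flux_rhoFun_ae.symm (Lp.coeFn_zero _ _ _).symm)

theorem memW2_rho_mul_test {φ : Eu n → ℝ} (hφ : IsTest D.Ω φ) :
    MemW2 D.Ω 2 (fun x => φ x * D.rhoFun x) :=
  D.memW2_rhoFun.mul_test D.isOpen hφ

/-- The drift cancels and the flux of `ρ_∞ φ` is `ν ρ_∞ ∇φ`, which has zero normal trace. This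
supplies enough elements of the domain for density. -/
theorem rho_mul_test_mem_domA {φ : Eu n → ℝ} (hφ : IsTest D.Ω φ) :
    (D.memW2_rho_mul_test hφ).1.toLp _ ∈ D.domA := by
  have hae := (D.memW2_rho_mul_test hφ).1.coeFn_toLp
  refine ⟨(D.memW2_rho_mul_test hφ).congr D.isOpen hae.symm, ?_⟩
  have h0 := D.hasWeakGrad_rho_mul (hφ.hasWeakGrad D.isOpen)
  simp only [mul_comm (D.rhoFun _) (φ _)] at h0
  refine ((D.normalTraceZero_rho_smul (hφ.normalTraceZero_gradient D.isOpen)).smul D.ν).congr ?_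
  filter_upwards [D.flux_ae (h0.congr D.isOpen hae.symm), hae] with x hx hx'
  rw [hx, hx', Pi.smul_apply, smul_sub, smul_smul _ (_ / _), mul_div_cancel₀ _ D.ν_pos.ne',
    sub_add_cancel]

/-- If `f` is orthogonal to all `ρ_∞ φ`, then `ρ_∞ f` vanishes as a distribution, and `ρ_∞ > 0`. -/
theorem dense_domA : Dense (D.domA : Set (L2 D.Ω)) := by
  rw [Submodule.dense_iff_topologicalClosure_eq_top, Submodule.topologicalClosure_eq_top_iff,
    Submodule.eq_bot_iff]
  intro f hf
  have hfρ : MemLp (fun x => D.rhoFun x * f x) 2 (volume.restrict D.Ω) :=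
    (Lp.memLp f).mul D.memLp_rhoFun_top
  have h0 := D.isOpen.ae_eq_zero_of_integral_contDiff_smul_eq_zero (μ := volume)
    (f := fun x => D.rhoFun x * f x)
    (locallyIntegrableOn_of_locallyIntegrable_restrict (hfρ.locallyIntegrable (by norm_num)))
    (fun φ h1 h2 h3 => by
      have hφ : IsTest D.Ω φ := ⟨h1, h2, h3⟩
      have e := (Submodule.mem_orthogonal _ _).1 hf _ (D.rho_mul_test_mem_domA hφ)
      rw [L2.inner_def] at e
      rw [← setIntegral_eq_integral_of_forall_compl_eq_zero (s := D.Ω) (fun x hx => by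
        rw [image_eq_zero_of_notMem_tsupport (fun hx' => hx (h3 hx')), zero_smul]), ← e]
      refine integral_congr_ae ?_
      filter_upwards [(D.memW2_rho_mul_test hφ).1.coeFn_toLp] with x hx
      rw [hx]
      simp only [smul_eq_mul, RCLike.inner_apply, conj_trivial]
      ring)
  refine (Lp.eq_zero_iff_ae_eq_zero).2 ((ae_restrict_iff' D.isOpen.measurableSet).2 ?_)
  filter_upwards [h0] with x hx hxΩ
  exact (mul_eq_zero.1 (hx hxΩ)).resolve_left (D.rhoFun_pos x).ne'

theorem P_of_mem (y : D.YP) : D.P y = y := by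
  refine Subtype.ext ?_
  rw [P_apply, (D.mem_YP _).1 y.2, zero_smul, sub_zero]

theorem P_rho : D.P D.rho = 0 := by
  refine Subtype.ext ?_
  rw [P_apply, ← inner_one, D.integral_rho, one_smul, sub_self]
  rfl

theorem P_mem_domain {y : L2 D.Ω} (hy : y ∈ D.A.domain) : D.P y ∈ D.Ahat.domain := by
  change (D.P y : L2 D.Ω) ∈ D.A.domain
  rw [P_apply]
  exact D.A.domain.sub_mem hy (D.A.domain.smul_mem _ D.rho_mem_domA)

/-- A continuous surjection maps dense sets to dense sets, and `P` maps `D(A)` into the domain of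
`Â`. -/
theorem dense_Ahat_domain : Dense (D.Ahat.domain : Set D.YP) := by
  have hs : Function.Surjective D.P := fun y => ⟨y, D.P_of_mem y⟩
  refine (hs.denseRange.dense_image D.P.continuous D.dense_domA).mono ?_
  rintro _ ⟨y, hy, rfl⟩
  exact D.P_mem_domain hy

/-- `y` and `P y` differ by a multiple of `ρ_∞`, which `A` kills. -/
theorem Ahat_P (y : D.A.domain) :
    (D.Ahat ⟨D.P y, D.P_mem_domain y.2⟩ : L2 D.Ω) = D.A y := by
  have h : (⟨D.P y, D.P_mem_domain y.2⟩ : D.A.domain) =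
      y - (∫ x in D.Ω, (y : L2 D.Ω) x) • ⟨D.rho, D.rho_mem_domA⟩ :=
    Subtype.ext (D.P_apply y)
  change D.A ⟨D.P y, D.P_mem_domain y.2⟩ = D.A y
  rw [h, LinearPMap.map_sub, LinearPMap.map_smul, A_rho, smul_zero, sub_zero]

end Problem

end FokkerPlanck

/-! ### The algebra of the two Riccati equations. -/

namespace FokkerPlanck

namespace Problem

variable {n : ℕ} (D : Problem n)

theorem inner_Θ (y : L2 D.Ω) (z : D.YP) : ⟪D.Θ y, z⟫_ℝ = ⟪y, (z : L2 D.Ω)⟫_ℝ :=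
  D.YP.inner_orthogonalProjectionOnto_eq_of_mem_right z y

theorem inner_coe_Θ (z : D.YP) (y : L2 D.Ω) : ⟪z, D.Θ y⟫_ℝ = ⟪(z : L2 D.Ω), y⟫_ℝ :=
  D.YP.inner_orthogonalProjectionOnto_eq_of_mem_left z y

theorem Θ_P_adjoint (z : D.YP) : D.Θ (D.P.adjoint z) = z :=
  ext_inner_right ℝ fun w => by
    rw [inner_Θ, ContinuousLinearMap.adjoint_inner_left, P_of_mem]

/-- As `B` takes values in `Y_P`, its adjoint sees only the `Y_P` component of `y`; in particular it
kills `𝟙`. -/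
theorem Bhat_adjoint_Θ (y : L2 D.Ω) : D.Bhat.adjoint (D.Θ y) = D.B.adjoint y :=
  ext_inner_right ℝ fun c => by
    rw [ContinuousLinearMap.adjoint_inner_left, ContinuousLinearMap.adjoint_inner_left, inner_Θ]
    exact congrArg (fun z : D.YP => ⟪y, (z : L2 D.Ω)⟫_ℝ) (D.P_of_mem ⟨D.B c, D.B_mem_YP c⟩)

theorem B_adjoint_P_adjoint (z : D.YP) : D.B.adjoint (D.P.adjoint z) = D.Bhat.adjoint z := by
  rw [← Bhat_adjoint_Θ, Θ_P_adjoint]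

theorem inner_one_coe (z : D.YP) : ⟪D.one, (z : L2 D.Ω)⟫_ℝ = 0 := by
  rw [inner_one, (D.mem_YP _).1 z.2]

theorem Θ_one : D.Θ D.one = 0 :=
  ext_inner_right ℝ fun z => by rw [inner_Θ, inner_one_coe, inner_zero_left]

theorem exists_eq_smul_one {y : L2 D.Ω} (hy : D.Θ y = 0) : ∃ γ : ℝ, y = γ • D.one := by
  have h : y ∈ (D.YP)ᗮ := by
    rw [Submodule.mem_orthogonal']
    intro z hz
    rw [← D.inner_Θ y ⟨z, hz⟩, hy, inner_zero_left]
  rw [YP, Submodule.orthogonal_orthogonal] at h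
  obtain ⟨γ, hγ⟩ := Submodule.mem_span_singleton.1 h
  exact ⟨γ, hγ.symm⟩

theorem P_add_smul_rho (y : L2 D.Ω) : (D.P y : L2 D.Ω) + ⟪D.one, y⟫_ℝ • D.rho = y := by
  rw [P_apply, inner_one, sub_add_cancel]

theorem coe_Ahat (y : D.Ahat.domain) :
    (D.Ahat y : L2 D.Ω) = D.A ⟨(y : D.YP), y.2⟩ := rfl

theorem Ahat_P_eq (y : D.A.domain) :
    D.Ahat ⟨D.P y, D.P_mem_domain y.2⟩ = D.P (D.A y) := by
  rw [← D.P_of_mem (D.Ahat _), Ahat_P]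

variable {D} {δ : ℝ} {M : D.YP →L[ℝ] D.YP}

/-- On `Y_P` the projection `P` is the identity, and `Θ` is invisible when paired with elements of
`Y_P`, so this is (R1) with arguments in `Y_P`. -/
theorem SolvesR1.compress {Pi : L2 D.Ω →L[ℝ] L2 D.Ω} (h : D.SolvesR1 δ M Pi) :
    D.SolvesR2 δ M (D.Θ ∘L Pi ∘L D.IP) := by
  have hs := ContinuousLinearMap.isSelfAdjoint_iff_isSymmetric.1 h.1
  refine ⟨ContinuousLinearMap.isSelfAdjoint_iff_isSymmetric.2 fun x y => ?_, fun y₁ y₂ => ?_⟩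
  · change ⟪D.Θ (Pi x), y⟫_ℝ = ⟪x, D.Θ (Pi y)⟫_ℝ
    rw [inner_Θ, inner_coe_Θ]
    exact hs x y
  · have e := h.2 ⟨(y₁ : D.YP), y₁.2⟩ ⟨(y₂ : D.YP), y₂.2⟩
    rw [← e]
    simp only [ContinuousLinearMap.comp_apply, inner_Θ, Bhat_adjoint_Θ, P_of_mem,
      ContinuousLinearMap.adjoint_inner_left]
    rfl

/-- `Π ρ_∞` is a multiple of `𝟙`. -/
theorem SolvesR1.apply_rho (hδ : D.Hautus δ) {Pi : L2 D.Ω →L[ℝ] L2 D.Ω}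
    (h : D.SolvesR1 δ M Pi) : ∃ γ : ℝ, Pi D.rho = γ • D.one := by
  set r : D.A.domain := ⟨D.rho, D.rho_mem_domA⟩ with hr
  -- With both arguments `ρ_∞`, only the quadratic term survives.
  have hB : D.B.adjoint (Pi D.rho) = 0 := by
    have e := h.2 r r
    simpa [hr, A_rho, P_rho] using e
  -- With `ρ_∞` in one slot the quadratic term is now zero too, which leaves a linear equation.
  have hA : ∀ y : D.A.domain, ⟪Pi D.rho, D.A y + δ • (D.P y : L2 D.Ω)⟫_ℝ = 0 := by
    intro y
    have e := h.2 r y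
    simpa [hr, A_rho, P_rho, hB] using e
  -- This exhibits `Θ Π ρ_∞` as an element of the domain of `Â*` with image `-δ Θ Π ρ_∞`.
  have hAhat : ∀ y : D.Ahat.domain,
      ⟪-δ • D.Θ (Pi D.rho), (y : D.YP)⟫_ℝ = ⟪D.Θ (Pi D.rho), D.Ahat y⟫_ℝ := by
    intro y
    have e := hA ⟨(y : D.YP), y.2⟩
    rw [P_of_mem, inner_add_right, inner_smul_right] at e
    refine (real_inner_smul_left (D.Θ (Pi D.rho)) (y : D.YP) (-δ)).trans ?_
    rw [inner_Θ, inner_Θ, coe_Ahat]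
    linarith
  have hdom := LinearPMap.mem_adjoint_domain_of_exists (T := D.Ahat) _ ⟨_, hAhat⟩
  refine D.exists_eq_smul_one (hδ (-δ) le_rfl ⟨_, hdom⟩
    (LinearPMap.adjoint_apply_eq D.dense_Ahat_domain ⟨_, hdom⟩ hAhat) ?_)
  rw [← hB]
  exact D.Bhat_adjoint_Θ _

/-- Split both arguments along `Y_P` and `ρ_∞`: by symmetry `⟪Π P y, ρ_∞⟫` is a multiple of `⟪P y,
𝟙⟫ = 0`, and the part of `y` along `ρ_∞` yields the `γ` term. -/
theorem eq_expand_compress {Pi : L2 D.Ω →L[ℝ] L2 D.Ω} (hs : IsSelfAdjoint Pi) {γ : ℝ}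
    (hγ : Pi D.rho = γ • D.one) :
    Pi = D.P.adjoint ∘L (D.Θ ∘L Pi ∘L D.IP) ∘L D.P + γ • D.oneOne := by
  have hsym := ContinuousLinearMap.isSelfAdjoint_iff_isSymmetric.1 hs
  refine ContinuousLinearMap.ext fun y => ext_inner_right ℝ fun z => ?_
  have e1 : ⟪(D.P.adjoint ∘L (D.Θ ∘L Pi ∘L D.IP) ∘L D.P) y, z⟫_ℝ =
      ⟪Pi (D.P y : L2 D.Ω), (D.P z : L2 D.Ω)⟫_ℝ := by
    rw [ContinuousLinearMap.comp_apply, ContinuousLinearMap.adjoint_inner_left]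
    exact D.inner_Θ _ _
  have e2 : ⟪(γ • D.oneOne) y, z⟫_ℝ = γ * (⟪D.one, y⟫_ℝ * ⟪D.one, z⟫_ℝ) := by
    simp [oneOne, inner_smul_left]
  have e3 : ⟪Pi (D.P y : L2 D.Ω), D.rho⟫_ℝ = 0 := by
    rw [show ⟪Pi (D.P y : L2 D.Ω), D.rho⟫_ℝ = ⟪(D.P y : L2 D.Ω), Pi D.rho⟫_ℝ from hsym _ _, hγ,
      inner_smul_right, real_inner_comm, inner_one_coe, mul_zero]
  rw [_root_.add_apply, inner_add_left, e1, e2]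
  conv_lhs => rw [← D.P_add_smul_rho y, map_add, map_smul, hγ]
  rw [inner_add_left]
  congr 1
  · conv_lhs => rw [← D.P_add_smul_rho z]
    rw [inner_add_right, inner_smul_right, e3, mul_zero, add_zero]
  · rw [real_inner_smul_left, real_inner_smul_left]
    ring

variable (D)

theorem expand_apply (Pihat : D.YP →L[ℝ] D.YP) (γ : ℝ) (y : L2 D.Ω) :
    (D.P.adjoint ∘L Pihat ∘L D.P + γ • D.oneOne) y =
      D.P.adjoint (Pihat (D.P y)) + (γ * ⟪D.one, y⟫_ℝ) • D.one := by
  rw [mul_smul]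
  rfl

theorem inner_expand (Pihat : D.YP →L[ℝ] D.YP) (γ : ℝ) (y z : L2 D.Ω) :
    ⟪(D.P.adjoint ∘L Pihat ∘L D.P + γ • D.oneOne) y, z⟫_ℝ =
      ⟪Pihat (D.P y), D.P z⟫_ℝ + γ * ⟪D.one, y⟫_ℝ * ⟪D.one, z⟫_ℝ := by
  rw [expand_apply, inner_add_left, ContinuousLinearMap.adjoint_inner_left, real_inner_smul_left]

theorem B_adjoint_expand (Pihat : D.YP →L[ℝ] D.YP) (γ : ℝ) (y : L2 D.Ω) :
    D.B.adjoint ((D.P.adjoint ∘L Pihat ∘L D.P + γ • D.oneOne) y) =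
      D.Bhat.adjoint (Pihat (D.P y)) := by
  rw [expand_apply, map_add, map_smul, B_adjoint_P_adjoint, ← Bhat_adjoint_Θ D D.one, Θ_one,
    map_zero, smul_zero, add_zero]

theorem isSelfAdjoint_expand {Pihat : D.YP →L[ℝ] D.YP} (h : IsSelfAdjoint Pihat) (γ : ℝ) :
    IsSelfAdjoint (D.P.adjoint ∘L Pihat ∘L D.P + γ • D.oneOne) := by
  have hs : ∀ y z, ⟪Pihat y, z⟫_ℝ = ⟪y, Pihat z⟫_ℝ :=
    ContinuousLinearMap.isSelfAdjoint_iff_isSymmetric.1 h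
  refine ContinuousLinearMap.isSelfAdjoint_iff_isSymmetric.2 fun y z => ?_
  refine (D.inner_expand Pihat γ y z).trans (Eq.trans ?_ (real_inner_comm _ _))
  refine Eq.trans ?_ (D.inner_expand Pihat γ z y).symm
  rw [hs, real_inner_comm]
  ring

/-- This makes the `γ` contributions to the linear terms of (R1) vanish. -/
theorem inner_one_generator (δ : ℝ) (y : D.A.domain) :
    ⟪D.one, D.A y + δ • (D.P y : L2 D.Ω)⟫_ℝ = 0 :=
  D.inner_one_coe (⟨D.A y, D.A_mem_YP y⟩ + δ • D.P y)

theorem P_generator (δ : ℝ) (y : D.A.domain) : D.P (D.A y + δ • (D.P y : L2 D.Ω)) =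
    D.Ahat ⟨D.P y, D.P_mem_domain y.2⟩ + δ • D.P y := by
  rw [Ahat_P_eq, (D.P).map_add, (D.P).map_smul, P_of_mem]

variable {D}

/-- Term by term, (R1) at `y₁, y₂` becomes (R2) at `P y₁, P y₂`: the `γ` terms die against `A + δP`
and under `B*`. -/
theorem SolvesR2.expand {Pihat : D.YP →L[ℝ] D.YP} (h : D.SolvesR2 δ M Pihat) (γ : ℝ) :
    D.SolvesR1 δ M (D.P.adjoint ∘L Pihat ∘L D.P + γ • D.oneOne) := by
  refine ⟨D.isSelfAdjoint_expand h.1 γ, fun y₁ y₂ => ?_⟩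
  have t1 := D.inner_expand Pihat γ y₁ (D.A y₂ + δ • (D.P y₂ : L2 D.Ω))
  rw [inner_one_generator, P_generator, mul_zero, add_zero] at t1
  have t2 := D.inner_expand Pihat γ (D.A y₁ + δ • (D.P y₁ : L2 D.Ω)) y₂
  rw [inner_one_generator, P_generator, mul_zero, zero_mul, add_zero] at t2
  have t3 := congrArg₂ (fun a b : ℝ => ⟪a, b⟫_ℝ)
    (D.B_adjoint_expand Pihat γ y₁) (D.B_adjoint_expand Pihat γ y₂)
  have t4 : ⟪(D.P.adjoint ∘L M ∘L D.P) y₁, (y₂ : L2 D.Ω)⟫_ℝ = ⟪M (D.P y₁), D.P y₂⟫_ℝ :=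
    ContinuousLinearMap.adjoint_inner_left D.P (y₂ : L2 D.Ω) (M (D.P y₁))
  have e := h.2 ⟨D.P y₁, D.P_mem_domain y₁.2⟩ ⟨D.P y₂, D.P_mem_domain y₂.2⟩
  exact (congrArg₂ (· + ·) (congrArg₂ (· - ·) (congrArg₂ (· + ·) t1 t2) t3) t4).trans e

end Problem

end FokkerPlanck

theorem mainTheorem6 {n : ℕ} (hn : 0 < n) (D : FokkerPlanck.Problem n) (δ : ℝ)
    (hδ : D.Hautus δ) (M : D.YP →L[ℝ] D.YP) (hM : M.IsPositive) :
    (∀ Pi : FokkerPlanck.L2 D.Ω →L[ℝ] FokkerPlanck.L2 D.Ω, D.SolvesR1 δ M Pi →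
      D.SolvesR2 δ M (D.Θ ∘L Pi ∘L D.IP) ∧
        ∃ γ : ℝ, Pi = D.P.adjoint ∘L (D.Θ ∘L Pi ∘L D.IP) ∘L D.P + γ • D.oneOne) ∧
    (∀ Pihat : D.YP →L[ℝ] D.YP, D.SolvesR2 δ M Pihat →
      ∀ γ : ℝ, D.SolvesR1 δ M (D.P.adjoint ∘L Pihat ∘L D.P + γ • D.oneOne)) := by
  refine ⟨fun Pi h => ⟨h.compress, ?_⟩, fun Pihat h γ => h.expand γ⟩
  obtain ⟨γ, hγ⟩ := h.apply_rho hδ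
  exact ⟨γ, FokkerPlanck.Problem.eq_expand_compress h.1 hγ⟩
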